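/- Let $q\in(0,\infty)$, let $\xi=(\xi_t)_{t\ge 0}$ and $\eta=(\eta_t)_{t\ge 0}$ be two independent real-valued Lévy processes, and let $\tau$ be an exponentially distributed random variable with parameter $q$ which is independent of $(\xi,\eta)$. Assume that $\xi$ is a compound Poisson process, i.e. there is a finite non-zero measure $\nu_\xi$ on $\mathbb{R}$ with $\nu_\xi(\{0\})=0$ such that $$E\,\mathrm{e}^{\mathrm{i}z\xi_t}=\exp\Bigl(t\int_{\mathbb{R}}(\mathrm{e}^{\mathrm{i}zx}-1)\,\nu_\xi(\mathrm{d}x)\Bigr),\qquad t\ge 0,\ z\in\mathbb{R}.$$ Then the killed exponential functional $$V_{q,\xi,\eta}:=\int_0^\tau \mathrm{e}^{-\xi_{s-}}\,\mathrm{d}\eta_s$$ (the stochastic integral process $t\mapsto\int_0^t \mathrm{e}^{-\xi_{s-}}\,\mathrm{d}\eta_s$, that is, the càdlàg process which is the limit, uniformly on compact time intervals in probability, of the left-endpoint Riemann sums along any sequence of partitions with mesh tending to $0$, evaluated at time $\tau$) exists, and the law of $V_{q,\xi,\eta}$ is absolutely continuous with respect to Lebesgue measure if and only if $\eta$ satisfies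 the ACP condition: there is some $p\in[0,\infty)$ such that the $p$-potential measure $$W_\eta^p(B)=\int_0^\infty \mathrm{e}^{-pt}\,P(\eta_t\in B)\,\mathrm{d}t,\qquad B\subseteq\mathbb{R}\ \text{Borel},$$ is absolutely continuous with respect to Lebesgue measure. -/

import Mathlib

open MeasureTheory ProbabilityTheory Filter Topology
open scoped NNReal ENNReal

noncomputable section

namespace KilledExpFunctional

variable {Ω : Type*} [MeasurableSpace Ω]

/-- A path on `[0, ∞)` that is right-continuous and has finite left limits. -/
def IsCadlag (f : ℝ≥0 → ℝ) : Prop :=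
  ∀ t : ℝ≥0, ContinuousWithinAt f (Set.Ici t) t ∧ ∃ l : ℝ, Tendsto f (𝓝[<] t) (𝓝 l)

/-- A real-valued Lévy process: it starts in `0`, has independent and stationary increments, and
almost surely càdlàg paths. -/
structure IsLevyProcess (X : ℝ≥0 → Ω → ℝ) (P : Measure Ω) : Prop where
  measurable : ∀ t, Measurable (X t)
  start_zero : ∀ᵐ ω ∂P, X 0 ω = 0
  indep_increments : HasIndepIncrements X P
  stationary_increments : ∀ s t : ℝ≥0,
    IdentDistrib (fun ω => X (s + t) ω - X s ω) (X t) P P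
  cadlag : ∀ᵐ ω ∂P, IsCadlag fun t => X t ω

/-- A compound Poisson process: a Lévy process without Gaussian part and without drift whose Lévy
measure `ν` is finite and non-zero (so the jump rate is `ν ℝ` and the jump distribution is
`ν / ν ℝ`), that is, `E exp (i z X_t) = exp (t ∫ (exp (i z x) - 1) ν(dx))`. -/
structure IsCompoundPoisson (X : ℝ≥0 → Ω → ℝ) (P : Measure Ω) : Prop where
  isLevyProcess : IsLevyProcess X P
  exists_levyMeasure : ∃ ν : Measure ℝ, IsFiniteMeasure ν ∧ ν ≠ 0 ∧ ν {0} = 0 ∧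
    ∀ (t : ℝ≥0) (z : ℝ), charFun (P.map (X t)) z =
      Complex.exp ((t : ℂ) * ∫ x : ℝ, (Complex.exp ((z : ℂ) * (x : ℂ) * Complex.I) - 1) ∂ν)

/-- A partition `0 = π 0 ≤ π 1 ≤ π 2 ≤ ⋯ → ∞` of `[0, ∞)`. -/
structure IsPartition (π : ℕ → ℝ≥0) : Prop where
  zero : π 0 = 0
  mono : Monotone π
  tendsto : Tendsto π atTop atTop

/-- The integral over `(0, t]` of the simple process taking the value `H (π i)` on
`(π i, π (i + 1)]`. For a partition `π` only finitely many terms are non-zero. -/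
def riemannSum (H X : ℝ≥0 → Ω → ℝ) (π : ℕ → ℝ≥0) (t : ℝ≥0) (ω : Ω) : ℝ :=
  ∑ᶠ i : ℕ, H (π i) ω * (X (min (π (i + 1)) t) ω - X (min (π i) t) ω)

/-- `I` is (a version of) the stochastic integral process `t ↦ ∫_{(0, t]} H_s dX_s` of an adapted
process `H` with left-continuous paths and right limits with respect to the semimartingale `X`:
the process with càdlàg paths which is the limit, uniformly on compact time intervals in
probability, of the integrals of the simple processes obtained by sampling `H` along any sequence
of partitions of mesh tending to `0`. Such an `I` is unique up to indistinguishability. -/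
structure IsStochasticIntegral (H X : ℝ≥0 → Ω → ℝ) (P : Measure Ω) (I : ℝ≥0 → Ω → ℝ) :
    Prop where
  aemeasurable : ∀ t, AEMeasurable (I t) P
  cadlag : ∀ᵐ ω ∂P, IsCadlag fun t => I t ω
  ucp_limit : ∀ π : ℕ → ℕ → ℝ≥0, (∀ n, IsPartition (π n)) →
    (∀ δ : ℝ≥0, 0 < δ → ∀ᶠ n in atTop, ∀ i, π n (i + 1) ≤ π n i + δ) →
    ∀ (t : ℝ≥0) (ε : ℝ), 0 < ε →
      Tendsto (fun n => P {ω | ∃ s ≤ t, ε ≤ |riemannSum H X (π n) s ω - I s ω|}) atTop (𝓝 0)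

/-- The process `s ↦ exp (-ξ_{s-})`, with the convention `ξ_{0-} = ξ_0`. -/
def expNegLeft (ξ : ℝ≥0 → Ω → ℝ) (s : ℝ≥0) (ω : Ω) : ℝ :=
  Real.exp (-Function.leftLim (fun u => ξ u ω) s)

/-- `V` is (a version of) the random variable `∫_0^τ exp (-ξ_{s-}) dη_s`. -/
def IsExpFunctional (ξ η : ℝ≥0 → Ω → ℝ) (τ : Ω → ℝ≥0) (P : Measure Ω) (V : Ω → ℝ) : Prop :=
  ∃ I : ℝ≥0 → Ω → ℝ, IsStochasticIntegral (expNegLeft ξ) η P I ∧ V =ᵐ[P] fun ω => I (τ ω) ω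

/-- `V` is a real random variable whose law is absolutely continuous with respect to Lebesgue
measure. -/
def IsAbsolutelyContinuousRV (V : Ω → ℝ) (P : Measure Ω) : Prop :=
  AEMeasurable V P ∧ P.map V ≪ volume

/-- The value `W^p(B) = ∫_0^∞ exp (-p t) P(X_t ∈ B) dt` of the `p`-potential measure of `X`. -/
def potentialMeasure (X : ℝ≥0 → Ω → ℝ) (P : Measure Ω) (p : ℝ≥0) (B : Set ℝ) : ℝ≥0∞ :=
  ∫⁻ t in Set.Ioi (0 : ℝ), ENNReal.ofReal (Real.exp (-(p * t))) * P {ω | X t.toNNReal ω ∈ B}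

/-- The ACP condition: for some `p ∈ [0, ∞)` the `p`-potential measure of `X` is absolutely
continuous with respect to Lebesgue measure. -/
def ACPCondition (X : ℝ≥0 → Ω → ℝ) (P : Measure Ω) : Prop :=
  ∃ p : ℝ≥0, ∀ B : Set ℝ, MeasurableSet B → volume B = 0 → potentialMeasure X P p B = 0

end KilledExpFunctional

end

noncomputable section

/-! Almost every path of `ξ` is a step function, so the integral `I` of `exp (-ξ_{s-})` against `η`
exists path by path: for a left-continuous step integrand the Riemann sums against a càdlàg path
converge locally uniformly, and `I_t - I_r = exp (-ξ_{r-}) (η_t - η_r)` for all `r < t` close enough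
to `t`.

Whatever `p` is, the ACP condition says that for each Lebesgue null set `B`, `P(η_t ∈ B) = 0` for
almost every `t > 0`. The law of `τ` has the same null sets as Lebesgue measure on `(0, ∞)`.

Let ACP hold. Almost surely some dyadic `r < τ` gives `I_τ = I_r + exp (-ξ_{r-}) (η_τ - η_r)`. For
fixed `r < t` the increment `η_t - η_r` is independent of `(I_r, exp (-ξ_{r-}))` and distributed as
`η_{t-r}`. Affine maps of nonzero slope preserve null sets, so almost surely the right side is
outside `B` when `r < τ`, and there are only countably many `r`
(`measure_expIntegralProcess_mem_eq_zero`).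

Conversely, `ξ` vanishes on `[0, M]` with positive probability, and then `I_τ = η_τ` if `τ ≤ M`.
This event is independent of `(η, τ)`, so a null set not charged by `I_τ` is not charged by `η_τ`,
and Fubini gives ACP (`acpCondition_of_null`).

Besides the Lévy property, all that is used of `ξ` is `P(ξ_t = 0) ≥ exp (-l t)`
(`IsCompoundPoisson.exists_rate`); it yields both the step paths and the positive probability. -/

namespace KilledExpFunctional

/-! ### Pathwise integrals of left-continuous step paths against càdlàg paths. -/

section Paths

/-- The left-endpoint Riemann sum of a path `h` against a path `g`. -/
def pathSum (h g : ℝ≥0 → ℝ) (π : ℕ → ℝ≥0) (t : ℝ≥0) : ℝ :=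
  ∑ᶠ i : ℕ, h (π i) * (g (min (π (i + 1)) t) - g (min (π i) t))

/-- A sequence of partitions of mesh tending to `0`. -/
structure IsPartitionSeq (π : ℕ → ℕ → ℝ≥0) : Prop where
  isPartition : ∀ n, IsPartition (π n)
  mesh : ∀ δ : ℝ≥0, 0 < δ → ∀ᶠ n in atTop, ∀ i, π n (i + 1) ≤ π n i + δ

lemma IsPartition.exists_le {π : ℕ → ℝ≥0} (hπ : IsPartition π) (t : ℝ≥0) :
    ∃ N, ∀ i, N ≤ i → t ≤ π i := by
  obtain ⟨N, hN⟩ := (hπ.tendsto.eventually_ge_atTop t).exists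
  exact ⟨N, fun i hi => hN.trans (hπ.mono hi)⟩

lemma pathSum_eq_sum_range (h g : ℝ≥0 → ℝ) {π : ℕ → ℝ≥0} {t : ℝ≥0} {N : ℕ}
    (hN : ∀ i, N ≤ i → t ≤ π i) :
    pathSum h g π t =
      ∑ i ∈ Finset.range N, h (π i) * (g (min (π (i + 1)) t) - g (min (π i) t)) := by
  refine finsum_eq_sum_of_support_subset _ fun i hi => ?_
  by_contra hiN
  have hiN : N ≤ i := by simpa using hiN
  apply hi
  simp only
  rw [min_eq_right (hN i hiN), min_eq_right (hN (i + 1) (by omega))]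
  simp

lemma pathSum_congr {h h' g : ℝ≥0 → ℝ} {π : ℕ → ℝ≥0} {t : ℝ≥0} (hπ : IsPartition π)
    (hh : ∀ s ≤ t, h s = h' s) : pathSum h g π t = pathSum h' g π t := by
  refine finsum_congr fun i => ?_
  rcases le_total (π i) t with hi | hi
  · rw [hh _ hi]
  · rw [min_eq_right hi, min_eq_right (hi.trans (hπ.mono i.le_succ))]
    simp

lemma pathSum_add (h h' g : ℝ≥0 → ℝ) {π : ℕ → ℝ≥0} (hπ : IsPartition π) (t : ℝ≥0) :
    pathSum (fun s => h s + h' s) g π t = pathSum h g π t + pathSum h' g π t := by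
  obtain ⟨N, hN⟩ := hπ.exists_le t
  simp only [pathSum_eq_sum_range _ _ hN, ← Finset.sum_add_distrib, add_mul]

lemma pathSum_const_mul (c : ℝ) (h g : ℝ≥0 → ℝ) {π : ℕ → ℝ≥0} (hπ : IsPartition π) (t : ℝ≥0) :
    pathSum (fun s => c * h s) g π t = c * pathSum h g π t := by
  obtain ⟨N, hN⟩ := hπ.exists_le t
  simp only [pathSum_eq_sum_range _ _ hN, Finset.mul_sum, mul_assoc]

lemma pathSum_one (g : ℝ≥0 → ℝ) {π : ℕ → ℝ≥0} (hπ : IsPartition π) (t : ℝ≥0) :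
    pathSum (fun _ => 1) g π t = g t - g 0 := by
  obtain ⟨N, hN⟩ := hπ.exists_le t
  simp only [pathSum_eq_sum_range _ _ hN, one_mul]
  rw [Finset.sum_range_sub (fun i => g (min (π i) t)), min_eq_right (hN N le_rfl), hπ.zero]
  simp

/-- The sampled integrand switches on at the first partition point `a` beyond `T`; from there the
sum telescopes. -/
lemma pathSum_indicator_Ioi (g : ℝ≥0 → ℝ) {π : ℕ → ℝ≥0} (hπ : IsPartition π) (T t : ℝ≥0)
    {δ : ℝ≥0} (hδ : ∀ i, π (i + 1) ≤ π i + δ) :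
    ∃ a, T ≤ a ∧ a ≤ T + δ ∧
      pathSum ((Set.Ioi T).indicator fun _ => 1) g π t = g t - g (min a t) := by
  classical
  have hex : ∃ j, T < π j := (hπ.tendsto.eventually_gt_atTop T).exists
  set j := Nat.find hex with hj
  have hj1 : T < π j := Nat.find_spec hex
  have hj2 : ∀ i < j, π i ≤ T := fun i hi => not_lt.1 (Nat.find_min hex hi)
  have hj0 : 0 < j := by
    rcases Nat.eq_zero_or_pos j with h | h
    · rw [h, hπ.zero] at hj1
      exact absurd hj1 (by simp)
    · exact h
  refine ⟨π j, hj1.le, ?_, ?_⟩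
  · have := hδ (j - 1)
    rw [Nat.sub_add_cancel hj0] at this
    exact this.trans (by gcongr; exact hj2 _ (by omega))
  · obtain ⟨N, hN⟩ := hπ.exists_le t
    have hN' : ∀ i, j + N ≤ i → t ≤ π i := fun i hi => hN i (by omega)
    rw [pathSum_eq_sum_range _ _ hN', Finset.sum_range_add, Finset.sum_eq_zero, zero_add]
    · have : ∀ i ∈ Finset.range N, (Set.Ioi T).indicator (fun _ => (1 : ℝ)) (π (j + i)) *
          (g (min (π (j + i + 1)) t) - g (min (π (j + i)) t)) =
          g (min (π (j + (i + 1))) t) - g (min (π (j + i)) t) := fun i _ => by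
        rw [Set.indicator_of_mem
          (show π (j + i) ∈ Set.Ioi T from hj1.trans_le (hπ.mono (by omega))), one_mul]
        rfl
      rw [Finset.sum_congr rfl this, Finset.sum_range_sub (fun i => g (min (π (j + i)) t)),
        min_eq_right (hN' _ le_rfl)]
      simp
    · intro i hi
      rw [Set.indicator_of_notMem, zero_mul]
      simpa using hj2 i (by simpa using hi)

lemma IsCadlag.add {f g : ℝ≥0 → ℝ} (hf : IsCadlag f) (hg : IsCadlag g) :
    IsCadlag fun t => f t + g t := fun t => by
  obtain ⟨a, ha⟩ := (hf t).2
  obtain ⟨b, hb⟩ := (hg t).2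
  exact ⟨(hf t).1.add (hg t).1, a + b, ha.add hb⟩

lemma IsCadlag.const_mul {f : ℝ≥0 → ℝ} (hf : IsCadlag f) (c : ℝ) :
    IsCadlag fun t => c * f t := fun t => by
  obtain ⟨a, ha⟩ := (hf t).2
  exact ⟨(hf t).1.const_mul c, c * a, ha.const_mul c⟩

lemma isCadlag_const (c : ℝ) : IsCadlag fun _ => c :=
  fun _ => ⟨continuousWithinAt_const, c, tendsto_const_nhds⟩

lemma IsCadlag.sub {f g : ℝ≥0 → ℝ} (hf : IsCadlag f) (hg : IsCadlag g) :
    IsCadlag fun t => f t - g t := by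
  simpa [sub_eq_add_neg] using hf.add (hg.const_mul (-1))

lemma IsCadlag.min_left {f : ℝ≥0 → ℝ} (hf : IsCadlag f) (T : ℝ≥0) :
    IsCadlag fun t => f (min T t) := fun t => by
  constructor
  · refine ContinuousWithinAt.comp (t := Set.Ici (min T t)) (hf _).1
      (by fun_prop) fun s hs => ?_
    exact min_le_min_left T hs
  · rcases le_or_gt t T with h | h
    · obtain ⟨a, ha⟩ := (hf t).2
      refine ⟨a, ha.congr' ?_⟩
      filter_upwards [self_mem_nhdsWithin] with s hs
      rw [min_eq_right ((le_of_lt hs).trans h)]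
    · refine ⟨f T, tendsto_const_nhds.congr' ?_⟩
      filter_upwards [mem_nhdsWithin_of_mem_nhds (lt_mem_nhds h)] with s hs
      rw [min_eq_left (le_of_lt hs)]

lemma IsCadlag.sum {ι : Type*} (s : Finset ι) {f : ι → ℝ≥0 → ℝ} (hf : ∀ i ∈ s, IsCadlag (f i)) :
    IsCadlag fun t => ∑ i ∈ s, f i t := by
  classical
  induction s using Finset.induction_on with
  | empty => simpa using isCadlag_const 0
  | insert a s ha ih =>
    simp only [Finset.sum_insert ha]
    exact (hf a (by simp)).add (ih fun i hi => hf i (by simp [hi]))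

/-- On `[0, T]` the path `J` is the locally uniform limit of the Riemann sums of `h` against `g`,
and it moves like a multiple of `g` immediately to the left of each point. -/
structure IsPathIntegral (h g : ℝ≥0 → ℝ) (T : ℝ≥0) (J : ℝ≥0 → ℝ) : Prop where
  cadlag : IsCadlag J
  tendsto : ∀ π, IsPartitionSeq π → ∀ ε > 0, ∀ᶠ n in atTop, ∀ s ≤ T,
    |pathSum h g (π n) s - J s| < ε
  local_eq : ∀ t, 0 < t → t ≤ T → ∀ᶠ r in 𝓝[<] t, J t - J r = h r * (g t - g r)

variable {h h' g J J' : ℝ≥0 → ℝ} {T : ℝ≥0}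

lemma IsPathIntegral.congr (hJ : IsPathIntegral h g T J) (hh : ∀ s ≤ T, h s = h' s) :
    IsPathIntegral h' g T J where
  cadlag := hJ.cadlag
  tendsto π hπ ε hε := (hJ.tendsto π hπ ε hε).mono fun n hn s hs => by
    rw [← pathSum_congr (hπ.isPartition n) fun u hu => hh u (hu.trans hs)]
    exact hn s hs
  local_eq t ht htT := by
    filter_upwards [hJ.local_eq t ht htT, self_mem_nhdsWithin] with r hr hrt
    rw [hr, hh r ((le_of_lt hrt).trans htT)]

lemma IsPathIntegral.add (hJ : IsPathIntegral h g T J) (hJ' : IsPathIntegral h' g T J') :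
    IsPathIntegral (fun s => h s + h' s) g T (fun s => J s + J' s) where
  cadlag := hJ.cadlag.add hJ'.cadlag
  tendsto π hπ ε hε := by
    filter_upwards [hJ.tendsto π hπ (ε / 2) (by positivity),
      hJ'.tendsto π hπ (ε / 2) (by positivity)] with n hn hn' s hs
    rw [pathSum_add _ _ _ (hπ.isPartition n)]
    have h1 := abs_lt.1 (hn s hs)
    have h2 := abs_lt.1 (hn' s hs)
    rw [abs_lt]
    constructor <;> linarith
  local_eq t ht htT := by
    filter_upwards [hJ.local_eq t ht htT, hJ'.local_eq t ht htT] with r hr hr'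
    linear_combination hr + hr'

lemma IsPathIntegral.const_mul (hJ : IsPathIntegral h g T J) (c : ℝ) :
    IsPathIntegral (fun s => c * h s) g T (fun s => c * J s) where
  cadlag := hJ.cadlag.const_mul c
  tendsto π hπ ε hε := by
    filter_upwards [hJ.tendsto π hπ (ε / (|c| + 1)) (by positivity)] with n hn s hs
    rw [pathSum_const_mul _ _ _ (hπ.isPartition n), ← mul_sub, abs_mul]
    have h1 := hn s hs
    rw [lt_div_iff₀ (by positivity)] at h1
    nlinarith [abs_nonneg (pathSum h g (π n) s - J s), abs_nonneg c]
  local_eq t ht htT := by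
    filter_upwards [hJ.local_eq t ht htT] with r hr
    linear_combination c * hr

lemma isPathIntegral_one (hg : IsCadlag g) :
    IsPathIntegral (fun _ => 1) g T (fun s => g s - g 0) where
  cadlag := hg.sub (isCadlag_const _)
  tendsto π hπ ε hε := Eventually.of_forall fun n s _ => by
    rw [pathSum_one _ (hπ.isPartition n)]
    simpa using hε
  local_eq t _ _ := Eventually.of_forall fun r => by ring

/-- The sums differ from the limit by an increment of `g` inside `[a, a + δ]`, small uniformly in
`s` by right-continuity at `a`. -/
lemma isPathIntegral_indicator_Ioi (hg : IsCadlag g) (a : ℝ≥0) :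
    IsPathIntegral ((Set.Ioi a).indicator fun _ => 1) g T (fun s => g s - g (min a s)) where
  cadlag := hg.sub (hg.min_left a)
  tendsto π hπ ε hε := by
    have h1 := (hg a).1
    rw [Metric.continuousWithinAt_iff] at h1
    obtain ⟨δ, hδ, h1⟩ := h1 ε hε
    lift δ to ℝ≥0 using hδ.le
    have hδ : 0 < δ := by exact_mod_cast hδ
    filter_upwards [hπ.mesh (δ / 2) (by positivity)] with n hn s _
    obtain ⟨b, hab, hb, h2⟩ := pathSum_indicator_Ioi g (hπ.isPartition n) a s hn
    rw [h2]
    rcases le_total s a with hs | hs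
    · rw [min_eq_right hs, min_eq_right (hs.trans hab)]
      simpa using hε
    · rw [min_eq_left hs]
      have h3 : a ≤ min b s := le_min hab hs
      have h4 := h1 (x := min b s) h3 ?_
      · rw [Real.dist_eq] at h4
        rwa [sub_sub_sub_cancel_left, abs_sub_comm]
      · rw [NNReal.dist_eq, abs_of_nonneg (by simpa using h3)]
        have h5 : ((min b s : ℝ≥0) : ℝ) ≤ (a + δ / 2 : ℝ≥0) := by
          exact_mod_cast (min_le_left _ _).trans hb
        have h6 : (0 : ℝ) < δ := hδ
        push_cast at h5 ⊢
        linarith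
  local_eq t _ _ := by
    rcases lt_or_ge a t with ha | ha
    · filter_upwards [mem_nhdsWithin_of_mem_nhds (lt_mem_nhds ha)] with r hr
      rw [Set.indicator_of_mem (by exact hr), min_eq_left ha.le, min_eq_left (le_of_lt hr)]
      ring
    · filter_upwards [self_mem_nhdsWithin] with r hr
      have hr : r < t := hr
      rw [Set.indicator_of_notMem (by simpa using (hr.trans_le ha).le), min_eq_right ha,
        min_eq_right (hr.le.trans ha)]
      ring

/-- A left-continuous step path: locally constant on both sides of each point, with the value
attained from the left. -/
structure IsLeftStep (h : ℝ≥0 → ℝ) : Prop where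
  right : ∀ t, ∃ c, ∀ᶠ s in 𝓝[>] t, h s = c
  left : ∀ t, 0 < t → ∀ᶠ s in 𝓝[<] t, h s = h t

lemma IsPathIntegral.tendsto_pathSum (hJ : IsPathIntegral h g T J) {π : ℕ → ℕ → ℝ≥0}
    (hπ : IsPartitionSeq π) {s : ℝ≥0} (hs : s ≤ T) :
    Tendsto (fun n => pathSum h g (π n) s) atTop (𝓝 (J s)) := by
  rw [Metric.tendsto_atTop']
  intro ε hε
  obtain ⟨N, hN⟩ := eventually_atTop.1 (hJ.tendsto π hπ ε hε)
  exact ⟨N, fun n hn => by rw [Real.dist_eq]; exact hN n hn.le s hs⟩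

/-- A supremum argument replaces listing the jumps: the integrable approximation of `h` can always
be pushed one jump further. -/
lemma IsLeftStep.exists_isPathIntegral (hh : IsLeftStep h) (hg : IsCadlag g) (T : ℝ≥0) :
    ∃ J, IsPathIntegral h g T J := by
  -- `k` agrees with `h` up to `s` and is frozen afterwards, so that the next jump can be added on
  -- top.
  let A : Set ℝ≥0 := {s | s ≤ T ∧ ∃ k J, (∀ S, IsPathIntegral k g S J) ∧ (∀ u ≤ s, k u = h u) ∧
    ∀ u, s ≤ u → k u = k s}
  suffices T ∈ A by
    obtain ⟨_, k, J, hJ, hk, -⟩ := this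
    exact ⟨J, (hJ T).congr hk⟩
  have h0 : (0 : ℝ≥0) ∈ A := by
    refine ⟨zero_le, fun _ => h 0 * 1, _, fun S => (isPathIntegral_one hg).const_mul (h 0), ?_,
      fun _ _ => rfl⟩
    intro u hu
    rw [nonpos_iff_eq_zero.1 hu, mul_one]
  have hbdd : BddAbove A := ⟨T, fun s hs => hs.1⟩
  set σ := sSup A with hσ
  have hσT : σ ≤ T := csSup_le ⟨0, h0⟩ fun s hs => hs.1
  -- `h` is constant just to the left of `σ`, so a `k` that works up to a nearby `s` already works
  -- up to `σ`.
  have hσA : σ ∈ A := by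
    rcases eq_or_ne σ 0 with h1 | h1
    · rwa [h1]
    have hpos : 0 < σ := pos_iff_ne_zero.2 h1
    obtain ⟨a, ha, hA⟩ := (mem_nhdsLT_iff_exists_Ioo_subset' hpos).1 (hh.left σ hpos)
    obtain ⟨s, hs, has⟩ := exists_lt_of_lt_csSup ⟨0, h0⟩ (show a < sSup A from ha)
    have hsσ : s ≤ σ := le_csSup hbdd hs
    have hval : ∀ u, a < u → u ≤ σ → h u = h σ := fun u hu hu' => by
      rcases hu'.eq_or_lt with rfl | h2
      · rfl
      · exact hA ⟨hu, h2⟩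
    obtain ⟨_, k, J, hJ, hk, hk'⟩ := hs
    refine ⟨hσT, k, J, hJ, fun u hu => ?_, fun u hu => ?_⟩
    · rcases le_total u s with h2 | h2
      · exact hk u h2
      · rw [hk' u h2, hk s le_rfl, hval s has hsσ, hval u (has.trans_le h2) hu]
    · rw [hk' u (hsσ.trans hu), hk' σ hsσ]
  rcases hσT.eq_or_lt with h1 | h1
  · rwa [← h1]
  exfalso
  obtain ⟨c, hc⟩ := hh.right σ
  obtain ⟨b, hb, hB⟩ := (mem_nhdsGT_iff_exists_Ioo_subset' h1).1 hc
  obtain ⟨b', hb1, hb2⟩ := exists_between (lt_min hb h1)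
  obtain ⟨_, k, J, hJ, hk, hk'⟩ := hσA
  -- Adding the jump of height `c - h σ` right after `σ` extends the agreement past the supremum.
  have : b' ∈ A := by
    refine ⟨(hb2.trans_le (min_le_right _ _)).le, _, _,
      fun S => (hJ S).add ((isPathIntegral_indicator_Ioi hg σ).const_mul (c - h σ)),
      fun u hu => ?_, fun u hu => ?_⟩
    · rcases le_or_gt u σ with h2 | h2
      · simp [Set.indicator_of_notMem (show u ∉ Set.Ioi σ by simpa using h2), hk u h2]
      · have h3 : h u = c := hB ⟨h2, hu.trans_lt (hb2.trans_le (min_le_left _ _))⟩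
        simp [Set.indicator_of_mem (show u ∈ Set.Ioi σ from h2), hk' u h2.le, hk σ le_rfl, h3]
    · simp [Set.indicator_of_mem (show u ∈ Set.Ioi σ from hb1.trans_le hu),
        Set.indicator_of_mem (show b' ∈ Set.Ioi σ from hb1), hk' u (hb1.le.trans hu),
        hk' b' hb1.le]
  exact absurd (le_csSup hbdd this) (not_le.2 hb1)

/-- The dyadic partition of `[0, ∞)` of mesh `2⁻ⁿ`. -/
def dyadic (n i : ℕ) : ℝ≥0 := i / 2 ^ n

lemma isPartitionSeq_dyadic : IsPartitionSeq dyadic where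
  isPartition n :=
    { zero := by simp [dyadic]
      mono := fun i j hij => by unfold dyadic; gcongr
      tendsto := tendsto_natCast_atTop_atTop.atTop_div_const (by positivity) }
  mesh δ hδ := by
    have h1 : Tendsto (fun n : ℕ => ((1 : ℝ≥0) / 2) ^ n) atTop (𝓝 0) :=
      tendsto_pow_atTop_nhds_zero_of_lt_one (by simp) (by
        rw [← NNReal.coe_lt_coe]; norm_num)
    filter_upwards [h1.eventually_lt_const hδ] with n hn i
    have : dyadic n (i + 1) = dyadic n i + (1 / 2) ^ n := by
      simp [dyadic, add_div]
    rw [this]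
    gcongr

/-- Integrals for different horizons are limits of the same dyadic sums, hence agree and can be
glued. -/
lemma IsLeftStep.exists_forall_isPathIntegral (hh : IsLeftStep h) (hg : IsCadlag g) :
    ∃ J, ∀ T, IsPathIntegral h g T J := by
  choose K hK using hh.exists_isPathIntegral hg
  have huniq : ∀ S T s, s ≤ S → s ≤ T → K S s = K T s := fun S T s hS hT =>
    tendsto_nhds_unique ((hK S).tendsto_pathSum isPartitionSeq_dyadic hS)
      ((hK T).tendsto_pathSum isPartitionSeq_dyadic hT)
  have hJ : ∀ T s, s ≤ T → K s s = K T s := fun T s hs => huniq s T s le_rfl hs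
  refine ⟨fun t => K t t, fun T => ⟨fun t => ?_, fun π hπ ε hε => ?_, fun t ht htT => ?_⟩⟩
  · have h1 : (fun s => K s s) =ᶠ[𝓝 t] K (t + 1) := by
      filter_upwards [gt_mem_nhds (show t < t + 1 by simp)] with s hs
      exact hJ _ s hs.le
    refine ⟨((hK (t + 1)).cadlag t).1.congr_of_eventuallyEq
      (h1.filter_mono nhdsWithin_le_nhds) (hJ _ t (by simp)), ?_⟩
    obtain ⟨l, hl⟩ := ((hK (t + 1)).cadlag t).2
    exact ⟨l, hl.congr' (h1.filter_mono nhdsWithin_le_nhds).symm⟩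
  · filter_upwards [(hK T).tendsto π hπ ε hε] with n hn s hs
    rw [hJ T s hs]
    exact hn s hs
  · filter_upwards [(hK T).local_eq t ht htT, self_mem_nhdsWithin] with r hr hrt
    rw [hJ T t htT, hJ T r ((le_of_lt hrt).trans htT), hr]

end Paths

/-! ### Recognising step paths from the number of changes along dyadic grids. -/

section StepPaths

/-- The left end of the dyadic interval of level `n` following the one that contains `s`. -/
def dyadicIdx (n : ℕ) (s : ℝ≥0) : ℕ := ⌊s * 2 ^ n⌋₊ + 1

lemma lt_dyadic_dyadicIdx (n : ℕ) (s : ℝ≥0) : s < dyadic n (dyadicIdx n s) := by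
  rw [dyadic, lt_div_iff₀ (by positivity), dyadicIdx]
  exact_mod_cast Nat.lt_floor_add_one (s * 2 ^ n)

lemma dyadic_dyadicIdx_le (n : ℕ) (s : ℝ≥0) : dyadic n (dyadicIdx n s) ≤ s + (1 / 2) ^ n := by
  rw [dyadic, div_le_iff₀ (by positivity), dyadicIdx, add_mul, ← mul_pow]
  push_cast
  have : (1 / 2 * 2 : ℝ≥0) = 1 := by norm_num
  rw [this, one_pow]
  gcongr
  exact Nat.floor_le (by positivity)

lemma tendsto_dyadic_dyadicIdx (s : ℝ≥0) :
    Tendsto (fun n => dyadic n (dyadicIdx n s)) atTop (𝓝[>] s) := by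
  refine tendsto_nhdsWithin_iff.2 ⟨?_, Eventually.of_forall fun n => lt_dyadic_dyadicIdx n s⟩
  have h1 : Tendsto (fun n : ℕ => s + ((1 : ℝ≥0) / 2) ^ n) atTop (𝓝 (s + 0)) :=
    (tendsto_pow_atTop_nhds_zero_of_lt_one (by simp) (by
        rw [← NNReal.coe_lt_coe]; norm_num)).const_add s
  rw [add_zero] at h1
  exact tendsto_of_tendsto_of_tendsto_of_le_of_le tendsto_const_nhds h1
    (fun n => (lt_dyadic_dyadicIdx n s).le) (fun n => dyadic_dyadicIdx_le n s)

lemma dyadic_eq_of_le {n m : ℕ} (h : n ≤ m) (i : ℕ) : dyadic n i = dyadic m (i * 2 ^ (m - n)) := by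
  obtain ⟨k, rfl⟩ := Nat.exists_eq_add_of_le h
  have : (2 : ℝ≥0) ^ k ≠ 0 := by positivity
  simp only [dyadic, Nat.add_sub_cancel_left, pow_add]
  push_cast
  rw [mul_div_mul_right _ _ this]

lemma dyadic_lt_dyadic {n i j : ℕ} : dyadic n i < dyadic n j ↔ i < j := by
  rw [dyadic, dyadic, div_lt_div_iff_of_pos_right (by positivity)]
  exact_mod_cast Iff.rfl

/-- The dyadic intervals of level `n` starting in `[a, b)` across which `f` changes. -/
def changes (f : ℝ≥0 → ℝ) (n : ℕ) (a b : ℝ≥0) : Set ℕ :=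
  {k | a ≤ dyadic n k ∧ dyadic n k < b ∧ f (dyadic n k) ≠ f (dyadic n (k + 1))}

variable {f : ℝ≥0 → ℝ}

lemma one_le_encard_changes {n i j : ℕ} (hij : i < j) (hf : f (dyadic n i) ≠ f (dyadic n j)) :
    1 ≤ (changes f n (dyadic n i) (dyadic n j)).encard := by
  rw [Set.one_le_encard_iff_nonempty]
  by_contra hne
  rw [Set.not_nonempty_iff_eq_empty, Set.eq_empty_iff_forall_notMem] at hne
  have : ∀ k, i ≤ k → k ≤ j → f (dyadic n i) = f (dyadic n k) := by
    intro k hk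
    induction k, hk using Nat.le_induction with
    | base => intro; rfl
    | succ k hk ih =>
      intro hkj
      rw [ih (by omega)]
      by_contra h
      exact hne k ⟨by unfold dyadic; gcongr, dyadic_lt_dyadic.2 (by omega), h⟩
  exact hf (this j hij.le le_rfl)

lemma encard_changes_add_le {n : ℕ} {a b c : ℝ≥0} (hab : a ≤ b) (hbc : b ≤ c) :
    (changes f n a b).encard + (changes f n b c).encard ≤ (changes f n a c).encard := by
  rw [← Set.encard_union_eq]
  · apply Set.encard_le_encard
    rintro k (hk | hk)
    · exact ⟨hk.1, hk.2.1.trans_le hbc, hk.2.2⟩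
    · exact ⟨hab.trans hk.1, hk.2⟩
  · rw [Set.disjoint_left]
    intro k hk hk'
    exact absurd hk'.1 (not_le.2 hk.2.1)

/-- Dyadic numbers. -/
def IsDyadic (d : ℝ≥0) : Prop := ∃ n i, d = dyadic n i

lemma eventually_one_le_encard_changes {a b : ℝ≥0} (ha : IsDyadic a) (hb : IsDyadic b)
    (hab : a < b) (hf : f a ≠ f b) : ∀ᶠ n in atTop, 1 ≤ (changes f n a b).encard := by
  obtain ⟨n, i, rfl⟩ := ha
  obtain ⟨m, j, rfl⟩ := hb
  filter_upwards [eventually_ge_atTop n, eventually_ge_atTop m] with l hl hl'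
  rw [dyadic_eq_of_le hl, dyadic_eq_of_le hl'] at hab hf ⊢
  exact one_le_encard_changes (dyadic_lt_dyadic.1 hab) hf

lemma exists_isDyadic_between {a b : ℝ≥0} (hab : a < b) : ∃ d, IsDyadic d ∧ a < d ∧ d < b := by
  have h := ((tendsto_dyadic_dyadicIdx a).eventually
    (mem_nhdsWithin_of_mem_nhds (gt_mem_nhds hab))).exists
  obtain ⟨n, hn⟩ := h
  exact ⟨_, ⟨n, _, rfl⟩, lt_dyadic_dyadicIdx n a, hn⟩

/-- By right-continuity a value is the limit of values at dyadic points to its right. -/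
lemma eq_of_forall_isDyadic (hf : ∀ t, ContinuousWithinAt f (Set.Ici t) t) {a b : ℝ≥0} {c : ℝ}
    (h : ∀ d, IsDyadic d → a < d → d < b → f d = c) {s : ℝ≥0} (has : a ≤ s) (hsb : s < b) :
    f s = c := by
  have h1 : Tendsto (fun n => f (dyadic n (dyadicIdx n s))) atTop (𝓝 (f s)) :=
    (hf s).tendsto.comp ((tendsto_dyadic_dyadicIdx s).mono_right
      (nhdsWithin_mono _ Set.Ioi_subset_Ici_self))
  refine tendsto_nhds_unique h1 (tendsto_const_nhds.congr' ?_)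
  filter_upwards [(tendsto_dyadic_dyadicIdx s).eventually
    (mem_nhdsWithin_of_mem_nhds (gt_mem_nhds hsb))] with n hn
  exact (h _ ⟨n, _, rfl⟩ (has.trans_lt (lt_dyadic_dyadicIdx n s)) hn).symm

/-- A path with bounded numbers of changes along dyadic grids is locally constant to the left of
every point. -/
lemma eventually_nhdsLT_eq (hf : ∀ t, ContinuousWithinAt f (Set.Ici t) t) {t : ℝ≥0} (ht : 0 < t)
    (hB : ∃ K : ℕ, ∃ᶠ n in atTop, (changes f n 0 t).encard ≤ K) :
    ∃ c, ∀ᶠ s in 𝓝[<] t, f s = c := by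
  by_contra hcon
  -- Without a constant stretch to the left of `t`, every dyadic point has a later one before `t`
  -- with a different value. Chaining these forces arbitrarily many changes on all fine grids.
  have step : ∀ d, IsDyadic d → d < t → ∃ d', IsDyadic d' ∧ d < d' ∧ d' < t ∧ f d ≠ f d' := by
    intro d _ hdt
    by_contra hno
    push Not at hno
    refine hcon ⟨f d, ?_⟩
    filter_upwards [Ioo_mem_nhdsLT hdt] with s hs
    exact eq_of_forall_isDyadic hf (fun d' h1 h2 h3 => (hno d' h1 h2 h3).symm) hs.1.le hs.2
  have key : ∀ m : ℕ, ∀ d, IsDyadic d → d < t →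
      ∀ᶠ n in atTop, (m : ℕ∞) ≤ (changes f n d t).encard := by
    intro m
    induction m with
    | zero => intro d _ _; simp
    | succ m ih =>
      intro d hd hdt
      obtain ⟨d', hd', h1, h2, h3⟩ := step d hd hdt
      filter_upwards [ih d' hd' h2, eventually_one_le_encard_changes hd hd' h1 h3] with n hn hn'
      push_cast
      rw [add_comm]
      exact (add_le_add hn' hn).trans (encard_changes_add_le h1.le h2.le)
  obtain ⟨K, hK⟩ := hB
  obtain ⟨n, hn, hn'⟩ :=
    (hK.and_eventually (key (K + 1) 0 ⟨0, 0, by simp [dyadic]⟩ ht)).exists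
  have := hn'.trans hn
  norm_cast at this
  omega

/-- Mirror image of `eventually_nhdsLT_eq`: the chain descends towards `t`, and the horizon `t + 1`
leaves room for its starting point. -/
lemma eventually_nhdsGT_eq (hf : ∀ t, ContinuousWithinAt f (Set.Ici t) t) {t : ℝ≥0}
    (hB : ∃ K : ℕ, ∃ᶠ n in atTop, (changes f n 0 (t + 1)).encard ≤ K) :
    ∃ c, ∀ᶠ s in 𝓝[>] t, f s = c := by
  by_contra hcon
  have step : ∀ d, IsDyadic d → t < d → ∃ d', IsDyadic d' ∧ t < d' ∧ d' < d ∧ f d' ≠ f d := by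
    intro d _ hdt
    by_contra hno
    push Not at hno
    refine hcon ⟨f d, ?_⟩
    filter_upwards [Ioo_mem_nhdsGT hdt] with s hs
    exact eq_of_forall_isDyadic hf hno hs.1.le hs.2
  have key : ∀ m : ℕ, ∀ d, IsDyadic d → t < d →
      ∀ᶠ n in atTop, (m : ℕ∞) ≤ (changes f n t d).encard := by
    intro m
    induction m with
    | zero => intro d _ _; simp
    | succ m ih =>
      intro d hd hdt
      obtain ⟨d', hd', h1, h2, h3⟩ := step d hd hdt
      filter_upwards [ih d' hd' h1, eventually_one_le_encard_changes hd' hd h2 h3] with n hn hn'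
      push_cast
      exact (add_le_add hn hn').trans (encard_changes_add_le h1.le h2.le)
  obtain ⟨K, hK⟩ := hB
  obtain ⟨d, hd, h1, h2⟩ := exists_isDyadic_between (show t < t + 1 by simp)
  obtain ⟨n, hn, hn'⟩ := (hK.and_eventually (key (K + 1) d hd h1)).exists
  have h3 : (changes f n t d).encard ≤ (changes f n 0 (t + 1)).encard :=
    Set.encard_le_encard fun k hk => ⟨zero_le, hk.2.1.trans h2, hk.2.2⟩
  have := (hn'.trans h3).trans hn
  norm_cast at this
  omega

lemma leftLim_eq_of_forall_Ioo {f : ℝ≥0 → ℝ} {a t : ℝ≥0} {c : ℝ} (hat : a < t)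
    (h : ∀ s, a < s → s < t → f s = c) : Function.leftLim f t = c := by
  have : (𝓝[<] t).NeBot := nhdsLT_neBot_of_exists_lt ⟨a, hat⟩
  refine leftLim_eq_of_tendsto (tendsto_const_nhds.congr' ?_)
  filter_upwards [Ioo_mem_nhdsLT hat] with s hs
  exact (h s hs.1 hs.2).symm

/-- The left-limit version of a path with bounded numbers of changes along dyadic grids is a
left-continuous step path. -/
lemma isLeftStep_leftLim (hf : ∀ t, ContinuousWithinAt f (Set.Ici t) t)
    (hB : ∀ t : ℝ≥0, ∃ K : ℕ, ∃ᶠ n in atTop, (changes f n 0 t).encard ≤ K) :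
    IsLeftStep (Function.leftLim f) where
  right t := by
    obtain ⟨c, hc⟩ := eventually_nhdsGT_eq hf (hB (t + 1))
    obtain ⟨b, hb, hB⟩ := (mem_nhdsGT_iff_exists_Ioo_subset' (show t < t + 1 by simp)).1 hc
    refine ⟨c, ?_⟩
    filter_upwards [Ioo_mem_nhdsGT hb] with s hs
    exact leftLim_eq_of_forall_Ioo hs.1 fun u hu hu' => hB ⟨hu, hu'.trans hs.2⟩
  left t ht := by
    obtain ⟨c, hc⟩ := eventually_nhdsLT_eq hf ht (hB t)
    obtain ⟨a, ha, hA⟩ := (mem_nhdsLT_iff_exists_Ioo_subset' ht).1 hc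
    have h1 : ∀ s, a < s → s ≤ t → Function.leftLim f s = c := fun s hs hst =>
      leftLim_eq_of_forall_Ioo hs fun u hu hu' => hA ⟨hu, hu'.trans_le hst⟩
    filter_upwards [Ioo_mem_nhdsLT ha] with s hs
    rw [h1 s hs.1 hs.2.le, h1 t ha le_rfl]

lemma IsLeftStep.comp {h : ℝ≥0 → ℝ} (hh : IsLeftStep h) (φ : ℝ → ℝ) :
    IsLeftStep fun t => φ (h t) where
  right t := by
    obtain ⟨c, hc⟩ := hh.right t
    exact ⟨φ c, hc.mono fun s hs => by rw [hs]⟩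
  left t ht := (hh.left t ht).mono fun s hs => by rw [hs]

end StepPaths

/-! ### The law of a compound Poisson process and its step paths. -/

section CompoundPoisson

/-- Convolution powers of a measure on the line. -/
def convPow (ν : Measure ℝ) : ℕ → Measure ℝ
  | 0 => Measure.dirac 0
  | k + 1 => ν ∗ convPow ν k

instance isFiniteMeasure_convPow (ν : Measure ℝ) [IsFiniteMeasure ν] (k : ℕ) :
    IsFiniteMeasure (convPow ν k) := by
  induction k with
  | zero => unfold convPow; infer_instance
  | succ k ih => unfold convPow; infer_instance

lemma charFun_convPow (ν : Measure ℝ) [IsFiniteMeasure ν] (k : ℕ) (z : ℝ) :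
    charFun (convPow ν k) z = charFun ν z ^ k := by
  induction k with
  | zero => simp [convPow]
  | succ k ih => rw [convPow, charFun_conv, ih, pow_succ']

lemma measureReal_univ_convPow (ν : Measure ℝ) [IsFiniteMeasure ν] (k : ℕ) :
    (convPow ν k).real Set.univ = ν.real Set.univ ^ k := by
  have h := charFun_convPow ν k 0
  rw [charFun_zero, charFun_zero] at h
  exact_mod_cast h

/-- The exponential series of `t ν` for the convolution product. -/
def convExp (ν : Measure ℝ) (t : ℝ) : Measure ℝ :=
  Measure.sum fun k : ℕ => ENNReal.ofReal (t ^ k / k.factorial) • convPow ν k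

lemma isFiniteMeasure_convExp (ν : Measure ℝ) [IsFiniteMeasure ν] {t : ℝ} (ht : 0 ≤ t) :
    IsFiniteMeasure (convExp ν t) := by
  constructor
  rw [convExp, Measure.sum_apply _ MeasurableSet.univ]
  have h1 : ∀ k : ℕ, (ENNReal.ofReal (t ^ k / k.factorial) • convPow ν k) Set.univ =
      ENNReal.ofReal ((t * ν.real Set.univ) ^ k / k.factorial) := fun k => by
    rw [Measure.smul_apply, ← ofReal_measureReal, measureReal_univ_convPow, smul_eq_mul,
      ← ENNReal.ofReal_mul (by positivity)]
    congr 1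
    ring
  simp_rw [h1]
  exact (Real.summable_pow_div_factorial _).tsum_ofReal_lt_top

lemma charFun_convExp (ν : Measure ℝ) [IsFiniteMeasure ν] {t : ℝ} (ht : 0 ≤ t) (z : ℝ) :
    charFun (convExp ν t) z = Complex.exp (t * charFun ν z) := by
  have := isFiniteMeasure_convExp ν ht
  have hint : Integrable (fun x : ℝ => Complex.exp (z * x * Complex.I)) (convExp ν t) := by
    refine Integrable.of_bound (by fun_prop) 1 (Eventually.of_forall fun x => ?_)
    rw [← Complex.ofReal_mul, Complex.norm_exp_ofReal_mul_I]
  have h1 := hasSum_integral_measure hint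
  have h2 := NormedSpace.expSeries_div_hasSum_exp ((t : ℂ) * charFun ν z)
  rw [← Complex.exp_eq_exp_ℂ] at h2
  rw [charFun_apply_real]
  refine h1.unique ?_
  convert! h2 using 2 with k
  rw [integral_smul_measure, ← charFun_apply_real, charFun_convPow,
    ENNReal.toReal_ofReal (by positivity), mul_pow, Complex.real_smul]
  push_cast
  ring

/-- The zeroth term of the series is the Dirac mass at `0`. -/
lemma one_le_convExp_singleton_zero (ν : Measure ℝ) (t : ℝ) : 1 ≤ convExp ν t {0} := by
  rw [convExp, Measure.sum_apply _ (measurableSet_singleton _)]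
  refine le_trans ?_ (ENNReal.le_tsum 0)
  simp [convPow]

variable {Ω : Type*} [MeasurableSpace Ω] {P : Measure Ω}
  {X : ℝ≥0 → Ω → ℝ}

/-- A compound Poisson process stays at `0` up to time `t` with exponentially small probability. -/
lemma IsCompoundPoisson.exists_rate [IsProbabilityMeasure P]
    (hX : IsCompoundPoisson X P) :
    ∃ l : ℝ, ∀ t : ℝ≥0, ENNReal.ofReal (Real.exp (-(l * t))) ≤ P (X t ⁻¹' {0}) := by
  obtain ⟨ν, hν, -, -, hchar⟩ := hX.exists_levyMeasure
  refine ⟨ν.real Set.univ, fun t => ?_⟩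
  have hfin := isFiniteMeasure_convExp ν t.coe_nonneg
  have hfin' : IsFiniteMeasure
      (ENNReal.ofReal (Real.exp (-(ν.real Set.univ * t))) • convExp ν t) :=
    (convExp ν t).smul_finite ENNReal.ofReal_ne_top
  have hm := hX.isLevyProcess.measurable t
  -- Both sides have the same characteristic function; the rate is the total mass of `ν`.
  have key : P.map (X t) =
      ENNReal.ofReal (Real.exp (-(ν.real Set.univ * t))) • convExp ν t := by
    have := Measure.isProbabilityMeasure_map (μ := P) hm.aemeasurable
    refine Measure.ext_of_charFun (funext fun z => ?_)
    have hint : Integrable (fun x : ℝ => Complex.exp (z * x * Complex.I)) ν := by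
      refine Integrable.of_bound (by fun_prop) 1 (Eventually.of_forall fun x => ?_)
      rw [← Complex.ofReal_mul, Complex.norm_exp_ofReal_mul_I]
    rw [hchar, charFun_apply_real, integral_smul_measure, ← charFun_apply_real,
      charFun_convExp ν t.coe_nonneg, ENNReal.toReal_ofReal (by positivity), Complex.real_smul,
      Complex.ofReal_exp, ← Complex.exp_add, integral_sub hint (integrable_const _),
      ← charFun_apply_real]
    congr 1
    simp
    ring
  rw [← Measure.map_apply hm (measurableSet_singleton _), key, Measure.smul_apply, smul_eq_mul]
  exact le_mul_of_one_le_right' (one_le_convExp_singleton_zero ν t)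

lemma IsLevyProcess.measure_increment_zero (hX : IsLevyProcess X P) (s t : ℝ≥0) :
    P {ω | X (s + t) ω - X s ω = 0} = P (X t ⁻¹' {0}) :=
  (hX.stationary_increments s t).measure_mem_eq (measurableSet_singleton 0)

lemma dyadic_succ (n k : ℕ) : dyadic n (k + 1) = dyadic n k + dyadic n 1 := by
  simp [dyadic, add_div]

lemma coe_dyadic (n k : ℕ) : (dyadic n k : ℝ) = k / 2 ^ n := by simp [dyadic]

lemma monotone_dyadic (n : ℕ) : Monotone (dyadic n) := fun i j hij => by unfold dyadic; gcongr

lemma dyadic_mul_pow (n M : ℕ) : dyadic n (M * 2 ^ n) = M := by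
  simp [dyadic]

/-- The `M * 2 ^ n` independent increments each vanish with probability at least `exp (-l / 2 ^ n)`;
the product of these bounds does not depend on `n`. -/
lemma le_measure_forall_dyadic_eq_zero (hX : IsLevyProcess X P) {l : ℝ}
    (hl : ∀ t : ℝ≥0, ENNReal.ofReal (Real.exp (-(l * t))) ≤ P (X t ⁻¹' {0})) (M n : ℕ) :
    ENNReal.ofReal (Real.exp (-(l * M))) ≤ P {ω | ∀ k ≤ M * 2 ^ n, X (dyadic n k) ω = 0} := by
  have h1 := hX.indep_increments.nat (monotone_dyadic n)
  have h2 := h1.measure_inter_preimage_eq_mul (Finset.range (M * 2 ^ n))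
    (sets := fun _ => {0}) (fun _ _ => measurableSet_singleton 0)
  have h3 : ∀ k, ENNReal.ofReal (Real.exp (-(l * dyadic n 1))) ≤
      P ((fun ω => X (dyadic n (k + 1)) ω - X (dyadic n k) ω) ⁻¹' {0}) := fun k => by
    have := hX.measure_increment_zero (dyadic n k) (dyadic n 1)
    rw [← dyadic_succ] at this
    exact (hl _).trans this.ge
  calc ENNReal.ofReal (Real.exp (-(l * M)))
      = ∏ _k ∈ Finset.range (M * 2 ^ n), ENNReal.ofReal (Real.exp (-(l * dyadic n 1))) := by
        rw [Finset.prod_const, Finset.card_range, ← ENNReal.ofReal_pow (by positivity),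
          ← Real.exp_nat_mul, coe_dyadic]
        congr 2
        push_cast
        field_simp
    _ ≤ _ := Finset.prod_le_prod' fun k _ => h3 k
    _ = _ := h2.symm
    _ ≤ _ := by
        refine measure_mono_ae ?_
        filter_upwards [hX.start_zero] with ω h0 hω
        change ω ∈ ⋂ i ∈ Finset.range (M * 2 ^ n), _ at hω
        change ∀ k ≤ M * 2 ^ n, X (dyadic n k) ω = 0
        simp only [Set.mem_iInter, Finset.mem_range, Set.mem_preimage, Set.mem_singleton_iff] at hω
        intro k
        induction k with
        | zero => intro _; simpa [dyadic] using h0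
        | succ k ih =>
          intro hk
          have h4 := hω k (by omega)
          have h5 := ih (by omega)
          linarith

/-- The events decrease as the grid is refined, and the lower bound is uniform in `n`. -/
lemma measure_forall_isDyadic_eq_zero_pos [IsProbabilityMeasure P]
    (hX : IsLevyProcess X P) {l : ℝ}
    (hl : ∀ t : ℝ≥0, ENNReal.ofReal (Real.exp (-(l * t))) ≤ P (X t ⁻¹' {0})) (M : ℕ) :
    0 < P {ω | ∀ n, ∀ k ≤ M * 2 ^ n, X (dyadic n k) ω = 0} := by
  have hmeas : ∀ n, MeasurableSet {ω | ∀ k ≤ M * 2 ^ n, X (dyadic n k) ω = 0} := fun n => by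
    simp only [Set.ofPred_forall]
    exact MeasurableSet.iInter fun k => MeasurableSet.iInter fun _ =>
      hX.measurable _ (measurableSet_singleton 0)
  have hanti : Antitone fun n => {ω | ∀ k ≤ M * 2 ^ n, X (dyadic n k) ω = 0} := by
    intro n m hnm ω hω k hk
    rw [dyadic_eq_of_le hnm]
    refine hω _ ((Nat.mul_le_mul_right _ hk).trans_eq ?_)
    rw [mul_assoc, ← pow_add, Nat.add_sub_cancel' hnm]
  have h1 := tendsto_measure_iInter_atTop (μ := P) (fun n => (hmeas n).nullMeasurableSet) hanti
    ⟨0, measure_ne_top _ _⟩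
  have h2 : (⋂ n, {ω | ∀ k ≤ M * 2 ^ n, X (dyadic n k) ω = 0}) =
      {ω | ∀ n, ∀ k ≤ M * 2 ^ n, X (dyadic n k) ω = 0} := by
    ext ω; simp
  rw [h2] at h1
  exact (ENNReal.ofReal_pos.2 (Real.exp_pos _)).trans_le
    (ge_of_tendsto' h1 fun n => le_measure_forall_dyadic_eq_zero hX hl M n)

/-- Since `1 - exp (-x) ≤ x`, the expected number of changes on `[0, M)` is at most `M * l` at every
level; Fatou makes its `liminf` almost surely finite. -/
lemma ae_frequently_encard_changes_le [IsProbabilityMeasure P]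
    (hX : IsLevyProcess X P) {l : ℝ}
    (hl : ∀ t : ℝ≥0, ENNReal.ofReal (Real.exp (-(l * t))) ≤ P (X t ⁻¹' {0})) (M : ℕ) :
    ∀ᵐ ω ∂P, ∃ K : ℕ, ∃ᶠ n in atTop, (changes (fun t => X t ω) n 0 M).encard ≤ K := by
  classical
  let A : ℕ → ℕ → Set Ω := fun n k => {ω | X (dyadic n (k + 1)) ω - X (dyadic n k) ω = 0}ᶜ
  have hA0 : ∀ n k, MeasurableSet {ω | X (dyadic n (k + 1)) ω - X (dyadic n k) ω = 0} :=
    fun n k => ((hX.measurable _).sub (hX.measurable _)) (measurableSet_singleton 0)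
  have hA : ∀ n k, MeasurableSet (A n k) := fun n k => (hA0 n k).compl
  let N : ℕ → Ω → ℝ≥0∞ := fun n ω => ∑ k ∈ Finset.range (M * 2 ^ n), (A n k).indicator 1 ω
  have hN : ∀ n, Measurable (N n) := fun n =>
    Finset.measurable_fun_sum _ fun k _ => measurable_one.indicator (hA n k)
  have hint : ∀ n, ∫⁻ ω, N n ω ∂P ≤ ENNReal.ofReal (M * l) := by
    intro n
    have h1 : ∀ k, P (A n k) ≤ ENNReal.ofReal (l / 2 ^ n) := by
      intro k
      have h2 := hX.measure_increment_zero (dyadic n k) (dyadic n 1)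
      rw [← dyadic_succ] at h2
      have h3 : P (A n k) = 1 - _ := prob_compl_eq_one_sub (hA0 n k)
      rw [h3, h2]
      refine (tsub_le_tsub_left (hl _) 1).trans ?_
      rw [← ENNReal.ofReal_one, ← ENNReal.ofReal_sub _ (by positivity)]
      refine ENNReal.ofReal_le_ofReal ?_
      have := Real.add_one_le_exp (-(l * dyadic n 1))
      rw [coe_dyadic] at this ⊢
      simp only [Nat.cast_one, mul_one_div] at this ⊢
      linarith
    calc ∫⁻ ω, N n ω ∂P = ∑ k ∈ Finset.range (M * 2 ^ n), P (A n k) := by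
          rw [lintegral_finsetSum _ fun k _ => measurable_one.indicator (hA n k)]
          exact Finset.sum_congr rfl fun k _ => lintegral_indicator_one (hA n k)
      _ ≤ ∑ _k ∈ Finset.range (M * 2 ^ n), ENNReal.ofReal (l / 2 ^ n) :=
          Finset.sum_le_sum fun k _ => h1 k
      _ = ENNReal.ofReal (M * l) := by
          rw [Finset.sum_const, Finset.card_range, nsmul_eq_mul, ← ENNReal.ofReal_natCast,
            ← ENNReal.ofReal_mul (by positivity)]
          congr 1
          push_cast
          field_simp
  have hfatou : ∫⁻ ω, liminf (fun n => N n ω) atTop ∂P ≠ ∞ := by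
    refine ((lintegral_liminf_le hN).trans ?_).trans_lt
      (ENNReal.ofReal_lt_top (r := M * l)) |>.ne
    exact (liminf_le_liminf (Eventually.of_forall hint)).trans (by simp)
  filter_upwards [ae_lt_top (Measurable.liminf hN) hfatou] with ω hω
  obtain ⟨K, hK⟩ := ENNReal.exists_nat_gt hω.ne
  -- A finite `liminf` bounds the count only for infinitely many levels, which suffices for the path
  -- lemmas.
  refine ⟨K, (frequently_lt_of_liminf_lt (by isBoundedDefault) hK).mono fun n hn => ?_⟩
  have h1 : changes (fun t => X t ω) n 0 M ⊆
      ((Finset.range (M * 2 ^ n)).filter fun k => ω ∈ A n k : Finset ℕ) := by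
    intro k hk
    rw [Finset.mem_coe, Finset.mem_filter, Finset.mem_range]
    refine ⟨?_, ?_⟩
    · have := hk.2.1
      rwa [← dyadic_mul_pow n M, dyadic_lt_dyadic] at this
    · intro h
      have h : X (dyadic n (k + 1)) ω - X (dyadic n k) ω = 0 := h
      exact hk.2.2 (by linarith)
  refine (Set.encard_le_encard h1).trans ?_
  rw [Set.encard_coe_eq_coe_finsetCard]
  have h2 : N n ω = (((Finset.range (M * 2 ^ n)).filter fun k => ω ∈ A n k).card : ℝ≥0∞) := by
    simp only [N, Set.indicator_apply, Pi.one_apply, Finset.natCast_card_filter]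
  rw [h2] at hn
  exact_mod_cast hn.le

/-- Almost every path of a compound Poisson process is a step path. -/
lemma IsCompoundPoisson.ae_isLeftStep [IsProbabilityMeasure P]
    (hX : IsCompoundPoisson X P) :
    ∀ᵐ ω ∂P, IsLeftStep (Function.leftLim fun t => X t ω) := by
  obtain ⟨l, hl⟩ := hX.exists_rate
  have h1 := ae_all_iff.2 (ae_frequently_encard_changes_le hX.isLevyProcess hl)
  filter_upwards [hX.isLevyProcess.cadlag, h1] with ω hω hω'
  refine isLeftStep_leftLim (fun t => (hω t).1) fun t => ?_
  obtain ⟨M, hM⟩ := exists_nat_ge t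
  obtain ⟨K, hK⟩ := hω' M
  refine ⟨K, hK.mono fun n hn => le_trans (Set.encard_le_encard ?_) hn⟩
  exact fun k hk => ⟨hk.1, hk.2.1.trans_le hM, hk.2.2⟩

end CompoundPoisson

/-! ### Measurable functionals on path space, built from countably many coordinates. -/

section PathFunctionals

/-- The value at `t` of a path, recovered from its values at dyadic times to the right of `t`. -/
def evalRight (t : ℝ≥0) (g : ℝ≥0 → ℝ) : ℝ :=
  limsup (fun n => g (dyadic n (dyadicIdx n t))) atTop

/-- The left limit of a path at `t`, recovered from a sequence of its values. -/
def leftVal (t : ℝ≥0) (f : ℝ≥0 → ℝ) : ℝ :=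
  limsup (fun n : ℕ => f (t * (n / (n + 1)))) atTop

/-- The integral up to `t` of `exp (-f (s-))` against `g`, as limit of dyadic Riemann sums. -/
def expIntegral (t : ℝ≥0) (p : (ℝ≥0 → ℝ) × (ℝ≥0 → ℝ)) : ℝ :=
  limsup (fun n => pathSum (fun s => Real.exp (-leftVal s p.1)) p.2 (dyadic n) t) atTop

lemma measurable_dyadicIdx (n : ℕ) : Measurable (dyadicIdx n) :=
  (Nat.measurable_floor.comp (measurable_id.mul_const _)).add_const 1

/-- Plain evaluation need not be jointly measurable in time and path; here each approximating time
takes countably many values. -/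
lemma measurable_evalRight : Measurable fun p : ℝ≥0 × (ℝ≥0 → ℝ) => evalRight p.1 p.2 := by
  refine Measurable.limsup fun n => ?_
  have h1 : Measurable fun p : ℕ × (ℝ≥0 → ℝ) => p.2 (dyadic n p.1) :=
    measurable_from_prod_countable_right fun k => measurable_pi_apply (dyadic n k)
  exact h1.comp (((measurable_dyadicIdx n).comp measurable_fst).prodMk measurable_snd)

lemma measurable_evalRight_comp {α : Type*} [MeasurableSpace α] {τ : α → ℝ≥0}
    {X : ℝ≥0 → α → ℝ} (hτ : Measurable τ) (hX : ∀ t, Measurable (X t)) :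
    Measurable fun a => evalRight (τ a) fun t => X t a := by
  have h := measurable_evalRight.comp (hτ.prodMk (measurable_pi_lambda _ hX))
  simpa only [Function.comp_def] using h

lemma measurable_leftVal (t : ℝ≥0) : Measurable (leftVal t) :=
  Measurable.limsup fun _ => measurable_pi_apply _

lemma measurable_pathSum {α : Type*} [MeasurableSpace α] {h g : α → ℝ≥0 → ℝ}
    (hh : ∀ s, Measurable fun a => h a s) (hg : ∀ s, Measurable fun a => g a s) {π : ℕ → ℝ≥0}
    (hπ : IsPartition π) (t : ℝ≥0) : Measurable fun a => pathSum (h a) (g a) π t := by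
  obtain ⟨N, hN⟩ := hπ.exists_le t
  simp only [pathSum_eq_sum_range _ _ hN]
  exact Finset.measurable_fun_sum _ fun i _ => (hh _).mul ((hg _).sub (hg _))

lemma measurable_expIntegral (t : ℝ≥0) : Measurable (expIntegral t) :=
  Measurable.limsup fun n => measurable_pathSum
    (fun s => (((measurable_leftVal s).comp measurable_fst).neg).exp)
    (fun s => (measurable_pi_apply s).comp measurable_snd)
    (isPartitionSeq_dyadic.isPartition n) t

/-- The integral up to `t` depends on the integrator up to `t` only. -/
lemma expIntegral_stopped (t : ℝ≥0) (f g : ℝ≥0 → ℝ) :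
    expIntegral t (f, fun u => g (min u t)) = expIntegral t (f, g) := by
  simp [expIntegral, pathSum]

lemma evalRight_eq {g : ℝ≥0 → ℝ} {t : ℝ≥0} (hg : ContinuousWithinAt g (Set.Ici t) t) :
    evalRight t g = g t :=
  (hg.tendsto.comp ((tendsto_dyadic_dyadicIdx t).mono_right
      (nhdsWithin_mono _ Set.Ioi_subset_Ici_self))).limsup_eq

lemma leftVal_eq_leftLim {f : ℝ≥0 → ℝ} (hf : IsCadlag f) (t : ℝ≥0) :
    leftVal t f = Function.leftLim f t := by
  -- At `0` both sides are `f 0`: the sampling sequence is constant there, and so is the convention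
  -- for `leftLim`.
  rcases eq_or_ne t 0 with rfl | ht
  · rw [leftLim_eq_of_isBot (a := (0 : ℝ≥0)) fun _ => zero_le]
    simp [leftVal]
  · have ht : 0 < t := pos_iff_ne_zero.2 ht
    obtain ⟨l, hl⟩ := (hf t).2
    have : (𝓝[<] t).NeBot := nhdsLT_neBot_of_exists_lt ⟨0, ht⟩
    rw [leftLim_eq_of_tendsto hl]
    refine (hl.comp (tendsto_nhdsWithin_iff.2 ⟨?_, Eventually.of_forall fun n => ?_⟩)).limsup_eq
    · have h1 : Tendsto (fun n : ℕ => (n : ℝ) / ((n : ℝ) + 1)) atTop (𝓝 1) :=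
        tendsto_natCast_div_add_atTop 1
      have h2 : Tendsto (fun n : ℕ => (n : ℝ≥0) / ((n : ℝ≥0) + 1)) atTop (𝓝 1) := by
        rw [← NNReal.tendsto_coe]
        push_cast
        exact h1
      simpa using h2.const_mul t
    · have h3 : (n : ℝ≥0) / (n + 1) < 1 := by
        rw [div_lt_one (by positivity)]
        simp
      exact mul_lt_of_lt_one_right ht h3

/-- Paths `f`, `g` for which `expIntegral` is the pathwise integral. -/
structure IsGoodPair (f g : ℝ≥0 → ℝ) : Prop where
  left : IsCadlag f
  right : IsCadlag g
  step : IsLeftStep (Function.leftLim f)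

lemma IsGoodPair.exp_leftVal {f g : ℝ≥0 → ℝ} (hfg : IsGoodPair f g) :
    (fun s => Real.exp (-leftVal s f)) = fun s => Real.exp (-Function.leftLim f s) :=
  funext fun s => by rw [leftVal_eq_leftLim hfg.left]

lemma IsGoodPair.isPathIntegral {f g : ℝ≥0 → ℝ} (hfg : IsGoodPair f g) (T : ℝ≥0) :
    IsPathIntegral (fun s => Real.exp (-leftVal s f)) g T (fun t => expIntegral t (f, g)) := by
  rw [hfg.exp_leftVal]
  obtain ⟨J, hJ⟩ := (hfg.step.comp fun x => Real.exp (-x)).exists_forall_isPathIntegral hfg.right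
  have : (fun t => expIntegral t (f, g)) = J := funext fun t => by
    have h1 := (hJ t).tendsto_pathSum isPartitionSeq_dyadic le_rfl
    rw [← hfg.exp_leftVal] at h1
    exact h1.limsup_eq
  rw [this]
  exact hJ T

lemma exists_cadlag_eq_pathSum (h : ℝ≥0 → ℝ) {g : ℝ≥0 → ℝ} (hg : IsCadlag g) {π : ℕ → ℝ≥0}
    (hπ : IsPartition π) (t : ℝ≥0) :
    ∃ F, IsCadlag F ∧ ∀ s ≤ t, pathSum h g π s = F s := by
  obtain ⟨N, hN⟩ := hπ.exists_le t
  refine ⟨fun s => ∑ i ∈ Finset.range N, h (π i) * (g (min (π (i + 1)) s) - g (min (π i) s)),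
    IsCadlag.sum _ fun i _ => ((hg.min_left _).sub (hg.min_left _)).const_mul _, fun s hs => ?_⟩
  exact pathSum_eq_sum_range _ _ fun i hi => hs.trans (hN i hi)

/-- Replaces a supremum over `[0, t]` by countably many times. Capping at `t` covers `s = t`, which
has no points to its right in the interval. -/
lemma IsCadlag.exists_min_dyadic_lt {F : ℝ≥0 → ℝ} (hF : IsCadlag F) {s t : ℝ≥0} (hs : s ≤ t)
    {ε : ℝ} (h : ε < |F s|) : ∃ n k, ε < |F (min (dyadic n k) t)| := by
  have h1 : Tendsto (fun n => min (dyadic n (dyadicIdx n s)) t) atTop (𝓝[≥] s) := by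
    refine tendsto_nhdsWithin_iff.2 ⟨?_, Eventually.of_forall fun n =>
      le_min (lt_dyadic_dyadicIdx n s).le hs⟩
    have h2 := ((tendsto_dyadic_dyadicIdx s).mono_right nhdsWithin_le_nhds).min
      (tendsto_const_nhds (x := t))
    rwa [min_eq_left hs] at h2
  obtain ⟨n, hn⟩ := (((hF s).1.tendsto.comp h1).abs.eventually_const_lt h).exists
  exact ⟨n, _, hn⟩

end PathFunctionals

/-! ### Existence and uniqueness of the stochastic integral. -/

section StochasticIntegral

variable {Ω : Type*} [MeasurableSpace Ω] {P : Measure Ω}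

variable {ξ η : ℝ≥0 → Ω → ℝ}

/-- The canonical version of the integral of `exp (-ξ_{s-})` against `η`. -/
def expIntegralProcess (ξ η : ℝ≥0 → Ω → ℝ) (t : ℝ≥0) (ω : Ω) : ℝ :=
  expIntegral t (fun s => ξ s ω, fun s => η s ω)

lemma measurable_expIntegralProcess (hξ : ∀ t, Measurable (ξ t)) (hη : ∀ t, Measurable (η t))
    (t : ℝ≥0) : Measurable (expIntegralProcess ξ η t) :=
  (measurable_expIntegral t).comp
    ((measurable_pi_lambda _ hξ).prodMk (measurable_pi_lambda _ hη))

/-- Almost sure locally uniform convergence implies convergence in probability, once the event over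
uncountably many times is enclosed in a measurable one. -/
lemma isStochasticIntegral_expIntegralProcess [IsFiniteMeasure P] (hξ : ∀ t, Measurable (ξ t))
    (hη : ∀ t, Measurable (η t))
    (hgood : ∀ᵐ ω ∂P, IsGoodPair (fun t => ξ t ω) (fun t => η t ω)) :
    IsStochasticIntegral (expNegLeft ξ) η P (expIntegralProcess ξ η) where
  aemeasurable t := (measurable_expIntegralProcess hξ hη t).aemeasurable
  cadlag := by
    filter_upwards [hgood] with ω hω
    exact (hω.isPathIntegral 0).cadlag
  ucp_limit π hπ hmesh t ε hε := by
    let R : ℕ → ℝ≥0 → Ω → ℝ := fun n s ω =>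
      pathSum (fun s => Real.exp (-leftVal s fun t => ξ t ω)) (fun s => η s ω) (π n) s -
        expIntegralProcess ξ η s ω
    have hR : ∀ n s, Measurable (R n s) := fun n s =>
      (measurable_pathSum
        (fun s => ((measurable_leftVal s).comp (measurable_pi_lambda _ hξ)).neg.exp) hη
        (hπ n) s).sub (measurable_expIntegralProcess hξ hη s)
    -- Halving `ε` turns the bound `ε ≤ |·|` into a strict one, which passes to nearby dyadic times.
    let B : ℕ → Set Ω := fun n => ⋃ m, ⋃ k, {ω | ε / 2 < |R n (min (dyadic m k) t) ω|}
    have hB : ∀ n, MeasurableSet (B n) := fun n => MeasurableSet.iUnion fun m =>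
      MeasurableSet.iUnion fun k => measurableSet_lt measurable_const (hR _ _).abs
    have hlim : Tendsto (fun n => P (B n)) atTop (𝓝 (P ∅)) := by
      refine tendsto_measure_of_ae_tendsto_indicator_of_isFiniteMeasure _ MeasurableSet.empty hB ?_
      filter_upwards [hgood] with ω hω
      filter_upwards [(hω.isPathIntegral t).tendsto π ⟨hπ, hmesh⟩ (ε / 2) (by positivity)]
        with n hn
      simp only [Set.mem_empty_iff_false, iff_false, B, Set.mem_iUnion, not_exists]
      intro m k hmk
      exact absurd (hn _ (min_le_right _ _)) (not_lt.2 (le_of_lt hmk))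
    rw [measure_empty] at hlim
    refine tendsto_of_tendsto_of_tendsto_of_le_of_le tendsto_const_nhds hlim
      (fun n => zero_le) fun n => measure_mono_ae ?_
    filter_upwards [hgood] with ω hω hA
    obtain ⟨s, hs, hsε⟩ := hA
    obtain ⟨F, hF, hF'⟩ := exists_cadlag_eq_pathSum
      (fun s => Real.exp (-leftVal s fun t => ξ t ω)) hω.right (hπ n) t
    have h1 : ∀ u ≤ t, R n u ω = F u - expIntegralProcess ξ η u ω := fun u hu => by
      simp only [R, hF' u hu]
    have h2 : ε / 2 < |F s - expIntegralProcess ξ η s ω| := by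
      rw [← hF' s hs, hω.exp_leftVal]
      exact (half_lt_self hε).trans_le hsε
    obtain ⟨m, k, hmk⟩ :=
      (hF.sub (hω.isPathIntegral 0).cadlag).exists_min_dyadic_lt hs h2
    refine Set.mem_iUnion.2 ⟨m, Set.mem_iUnion.2 ⟨k, ?_⟩⟩
    change ε / 2 < |R n (min (dyadic m k) t) ω|
    rwa [h1 _ (min_le_right _ _)]

/-- Stochastic integral processes are unique up to indistinguishability. -/
lemma IsStochasticIntegral.ae_eq {H X I I' : ℝ≥0 → Ω → ℝ} (hI : IsStochasticIntegral H X P I)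
    (hI' : IsStochasticIntegral H X P I') : ∀ᵐ ω ∂P, ∀ t, I t ω = I' t ω := by
  have key : ∀ M k : ℕ,
      P {ω | ∃ s ≤ (M : ℝ≥0), 2 * (1 / ((k : ℝ) + 1)) ≤ |I s ω - I' s ω|} = 0 := by
    intro M k
    have h1 := hI.ucp_limit dyadic isPartitionSeq_dyadic.isPartition isPartitionSeq_dyadic.mesh
      M (1 / ((k : ℝ) + 1)) (by positivity)
    have h2 := hI'.ucp_limit dyadic isPartitionSeq_dyadic.isPartition isPartitionSeq_dyadic.mesh
      M (1 / ((k : ℝ) + 1)) (by positivity)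
    have h3 := h1.add h2
    rw [add_zero] at h3
    refine le_antisymm (ge_of_tendsto' h3 fun n => (measure_mono ?_).trans (measure_union_le _ _))
      zero_le
    rintro ω ⟨s, hs, hsε⟩
    by_contra hcon
    simp only [Set.mem_union, not_or] at hcon
    have h4 : |riemannSum H X (dyadic n) s ω - I s ω| < 1 / ((k : ℝ) + 1) := by
      by_contra h; exact hcon.1 ⟨s, hs, not_lt.1 h⟩
    have h5 : |riemannSum H X (dyadic n) s ω - I' s ω| < 1 / ((k : ℝ) + 1) := by
      by_contra h; exact hcon.2 ⟨s, hs, not_lt.1 h⟩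
    have h6 : |I s ω - I' s ω| < 1 / ((k : ℝ) + 1) + 1 / ((k : ℝ) + 1) := by
      have h4 := abs_lt.1 h4
      have h5 := abs_lt.1 h5
      rw [abs_lt]
      constructor <;> linarith
    linarith
  have h1 : ∀ᵐ ω ∂P, ∀ M k : ℕ,
      ¬ ∃ s ≤ (M : ℝ≥0), 2 * (1 / ((k : ℝ) + 1)) ≤ |I s ω - I' s ω| :=
    ae_all_iff.2 fun M => ae_all_iff.2 fun k => measure_eq_zero_iff_ae_notMem.1 (key M k)
  filter_upwards [h1] with ω hω t
  obtain ⟨M, hM⟩ := exists_nat_ge t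
  by_contra hne
  have h2 : 0 < |I t ω - I' t ω| := abs_pos.2 (sub_ne_zero.2 hne)
  obtain ⟨k, hk⟩ := exists_nat_one_div_lt (half_pos h2)
  exact hω M k ⟨t, hM, by linarith⟩

lemma aemeasurable_expIntegralProcess_comp (hξ : ∀ t, Measurable (ξ t))
    (hη : ∀ t, Measurable (η t))
    (hgood : ∀ᵐ ω ∂P, IsGoodPair (fun t => ξ t ω) (fun t => η t ω)) {τ : Ω → ℝ≥0}
    (hτ : Measurable τ) : AEMeasurable (fun ω => expIntegralProcess ξ η (τ ω) ω) P := by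
  refine AEMeasurable.congr
    (measurable_evalRight_comp hτ (measurable_expIntegralProcess hξ hη)).aemeasurable ?_
  filter_upwards [hgood] with ω hω
  have h2 : IsCadlag fun t => expIntegralProcess ξ η t ω := (hω.isPathIntegral 0).cadlag
  exact evalRight_eq (h2 (τ ω)).1

end StochasticIntegral

/-! ### Independence of the past from later increments. -/

section Independence

variable {Ω : Type*} [MeasurableSpace Ω] {P : Measure Ω}

/-- The joint law is a product of three marginals, which can be bracketed either way. -/
lemma indepFun_prodMk_of_prodMk [IsProbabilityMeasure P] {α β γ : Type*} [MeasurableSpace α]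
    [MeasurableSpace β] [MeasurableSpace γ] {A : Ω → α} {B : Ω → β} {C : Ω → γ} (hA : Measurable A)
    (hB : Measurable B) (hC : Measurable C) (hAB : IndepFun A B P)
    (hABC : IndepFun (fun ω => (A ω, B ω)) C P) : IndepFun A (fun ω => (B ω, C ω)) P := by
  have hBC : IndepFun B C P := hABC.comp measurable_snd measurable_id
  have := Measure.isProbabilityMeasure_map (μ := P) hA.aemeasurable
  have := Measure.isProbabilityMeasure_map (μ := P) hB.aemeasurable
  have := Measure.isProbabilityMeasure_map (μ := P) hC.aemeasurable
  rw [indepFun_iff_map_prod_eq_prod_map_map hA.aemeasurable (hB.prodMk hC).aemeasurable,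
    hBC.map_prod_eq_prod_map_map hB.aemeasurable hC.aemeasurable, ← Measure.prodAssoc_prod,
    ← hAB.map_prod_eq_prod_map_map hA.aemeasurable hB.aemeasurable,
    ← hABC.map_prod_eq_prod_map_map (hA.prodMk hB).aemeasurable hC.aemeasurable,
    Measure.map_map MeasurableEquiv.prodAssoc.measurable ((hA.prodMk hB).prodMk hC)]
  rfl

variable {X : ℝ≥0 → Ω → ℝ}

/-- Along the sorted times `min i r`, preceded by `0`, each past value is a sum of increments before
`r`, and these are jointly independent of the increment from `r` to `t`. -/
lemma IsLevyProcess.indepFun_finset_sub (hX : IsLevyProcess X P) {r t : ℝ≥0} (hrt : r ≤ t)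
    (I : Finset ℝ≥0) :
    IndepFun (fun ω (i : I) => X (min i r) ω) (fun ω => X t ω - X r ω) P := by
  classical
  let l := (insert 0 (I.image (min · r))).sort (· ≤ ·)
  have hl : l.SortedLE := (Finset.pairwise_sort _ _).sortedLE
  have hmem : ∀ u, u ∈ l ↔ u = 0 ∨ ∃ i ∈ I, min i r = u := fun u => by simp [l]
  have hlr : ∀ u ∈ l, u ≤ r := fun u hu => by
    rcases (hmem u).1 hu with rfl | ⟨i, -, rfl⟩
    · exact zero_le
    · exact min_le_right _ _
  -- The sorted list, then `r`, then `t` forever: increment number `l.length` is `X t - X r`.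
  let s : ℕ → ℝ≥0 := fun i => if h : i < l.length then l[i] else if i = l.length then r else t
  have hs : Monotone s := by
    intro i j hij
    simp only [s]
    split_ifs with h1 h2 h3 h4 h5 h6 h7 h8
    · exact hl.getElem_le_getElem_of_le hij
    · exact hlr _ (List.getElem_mem _)
    · exact (hlr _ (List.getElem_mem _)).trans hrt
    · omega
    · exact le_rfl
    · exact hrt
    · omega
    · omega
    · exact le_rfl
  have hlen : 0 < l.length := List.length_pos_of_mem ((hmem 0).2 (Or.inl rfl))
  have hs0 : s 0 = 0 := by
    obtain ⟨n, hn, hn0⟩ := List.getElem_of_mem ((hmem 0).2 (Or.inl rfl))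
    have h1 : s n = 0 := by simp [s, hn, hn0]
    exact le_antisymm (h1 ▸ hs (Nat.zero_le n)) zero_le
  have hsL : s l.length = r := by simp [s]
  have hsL' : s (l.length + 1) = t := by simp [s]
  let D : ℕ → Ω → ℝ := fun i ω => X (s (i + 1)) ω - X (s i) ω
  have hD : iIndepFun D P := hX.indep_increments.nat hs
  have hDm : ∀ i, Measurable (D i) := fun i => (hX.measurable _).sub (hX.measurable _)
  have h1 := hD.indepFun_finset (Finset.range l.length) {l.length} (by simp) hDm
  have hidx : ∀ i : I, ∃ j ≤ l.length, s j = min (i : ℝ≥0) r := fun i => by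
    obtain ⟨n, hn, hn'⟩ := List.getElem_of_mem ((hmem (min (i : ℝ≥0) r)).2 (Or.inr ⟨i, i.2, rfl⟩))
    exact ⟨n, hn.le, by simp [s, hn, hn']⟩
  choose j hj hj' using hidx
  have h2 : IndepFun (fun ω (i : I) => ∑ k ∈ Finset.range (j i), D k ω)
      (fun ω => X t ω - X r ω) P := by
    have hψ : Measurable fun x : (({l.length} : Finset ℕ) → ℝ) => x ⟨l.length, by simp⟩ :=
      measurable_pi_apply _
    have h3 := h1.comp
      (φ := fun x (i : I) => ∑ k : Finset.range l.length, if (k : ℕ) < j i then x k else 0)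
      (ψ := fun x : (({l.length} : Finset ℕ) → ℝ) => x ⟨l.length, by simp⟩)
      (measurable_pi_lambda _ fun i => Finset.measurable_fun_sum _ fun k _ => by
        split_ifs
        · exact measurable_pi_apply k
        · exact measurable_const)
      hψ
    convert h3 using 1
    · ext ω i
      simp only [Function.comp]
      rw [Finset.sum_coe_sort (Finset.range l.length) fun k => if k < j i then D k ω else 0,
        ← Finset.sum_filter]
      refine Finset.sum_congr ?_ fun _ _ => rfl
      ext k
      have := hj i
      simp only [Finset.mem_range, Finset.mem_filter]
      omega
    · ext ω
      simp [D, hsL, hsL']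
  refine h2.congr ?_ .rfl
  filter_upwards [hX.start_zero] with ω h0
  ext i
  simp only [D]
  rw [Finset.sum_range_sub (fun k => X (s k) ω), hs0, h0, hj', sub_zero]

/-- The path up to time `r` is independent of later increments. -/
lemma IsLevyProcess.indepFun_stopped_sub [IsProbabilityMeasure P] (hX : IsLevyProcess X P)
    {r t : ℝ≥0} (hrt : r ≤ t) :
    IndepFun (fun ω u => X (min u r) ω) (fun ω => X t ω - X r ω) P :=
  IndepFun.process_indepFun (X := fun u ω => X (min u r) ω) (fun _ => hX.measurable _)
    ((hX.measurable t).sub (hX.measurable r)) fun I => hX.indepFun_finset_sub hrt I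

end Independence

/-! ### Null sets of times, and a reformulation of ACP. -/

section ExponentialTime

variable {Ω : Type*} [MeasurableSpace Ω] {P : Measure Ω}

/-- The exponential density is positive on `(0, ∞)` and zero on negative numbers, and `{0}` is a
null set. -/
lemma ae_map_exponential_iff {τ : Ω → ℝ≥0} {q : ℝ} (hq : 0 < q) (hτm : Measurable τ)
    (hτ : HasLaw (fun ω => (τ ω : ℝ)) (expMeasure q) P) {p : ℝ≥0 → Prop}
    (hp : MeasurableSet {t | p t}) :
    (∀ᵐ t ∂P.map τ, p t) ↔ ∀ᵐ x ∂volume.restrict (Set.Ioi (0 : ℝ)), p x.toNNReal := by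
  have h1 : P.map τ = (expMeasure q).map Real.toNNReal := by
    rw [← hτ.map_eq, Measure.map_map measurable_real_toNNReal hτm.coe_nnreal_real]
    congr 1
    ext ω
    simp
  rw [h1, ae_map_iff measurable_real_toNNReal.aemeasurable hp, expMeasure, gammaMeasure,
    ae_withDensity_iff (f := gammaPDF 1 q) (measurable_gammaPDFReal 1 q).ennreal_ofReal,
    ae_restrict_iff' measurableSet_Ioi]
  have h0 : ∀ᵐ x : ℝ ∂volume, x ≠ 0 := by simp [ae_iff]
  constructor
  · intro h
    filter_upwards [h] with x hx hx0
    exact hx (ENNReal.ofReal_pos.2 (exponentialPDFReal_pos hq hx0)).ne'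
  · intro h
    filter_upwards [h, h0] with x hx hx0 hpdf
    rcases lt_or_ge x 0 with hneg | hpos
    · exact absurd (gammaPDF_of_neg hneg) hpdf
    · exact hx (lt_of_le_of_ne hpos hx0.symm)

lemma IsLevyProcess.ae_evalRight_eq {X : ℝ≥0 → Ω → ℝ} (hX : IsLevyProcess X P) :
    ∀ᵐ ω ∂P, ∀ t, evalRight t (fun s => X s ω) = X t ω := by
  filter_upwards [hX.cadlag] with ω hω t
  exact evalRight_eq (hω t).1

lemma measurable_measure_mem [SFinite P] {α : Type*} [MeasurableSpace α] {Y : α → Ω → ℝ}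
    (hY : Measurable fun p : α × Ω => Y p.1 p.2) {B : Set ℝ} (hB : MeasurableSet B) :
    Measurable fun a => P {ω | Y a ω ∈ B} :=
  measurable_measure_prodMk_left (hY hB)

lemma measurable_evalRight_path {X : ℝ≥0 → Ω → ℝ} (hX : ∀ t, Measurable (X t)) :
    Measurable fun p : ℝ≥0 × Ω => evalRight p.1 fun s => X s p.2 :=
  measurable_evalRight_comp (X := fun s (p : ℝ≥0 × Ω) => X s p.2) measurable_fst
    fun t => (hX t).comp measurable_snd

/-- `X` itself is not assumed jointly measurable; for each `t` it agrees almost surely with its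
`evalRight` version, which is. -/
lemma IsLevyProcess.measurable_measure_mem [SFinite P] {X : ℝ≥0 → Ω → ℝ}
    (hX : IsLevyProcess X P) {B : Set ℝ} (hB : MeasurableSet B) :
    Measurable fun t => P {ω | X t ω ∈ B} := by
  have h := KilledExpFunctional.measurable_measure_mem (P := P)
    (Y := fun t ω => evalRight t fun s => X s ω) (measurable_evalRight_path hX.measurable) hB
  convert h using 2 with t
  refine measure_congr ?_
  filter_upwards [hX.ae_evalRight_eq] with ω hω
  change (X t ω ∈ B) = (evalRight t (fun s => X s ω) ∈ B)
  rw [hω t]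

/-- The ACP condition says that null sets are not charged at almost all times. -/
lemma IsLevyProcess.acpCondition_iff [SFinite P] {X : ℝ≥0 → Ω → ℝ} (hX : IsLevyProcess X P) :
    ACPCondition X P ↔ ∀ B : Set ℝ, MeasurableSet B → volume B = 0 →
      ∀ᵐ x ∂volume.restrict (Set.Ioi (0 : ℝ)), P {ω | X x.toNNReal ω ∈ B} = 0 := by
  -- The weight `exp (-p t)` is positive, so `p` plays no role for null sets.
  have key : ∀ (p : ℝ≥0) (B : Set ℝ), MeasurableSet B → (potentialMeasure X P p B = 0 ↔
      ∀ᵐ x ∂volume.restrict (Set.Ioi (0 : ℝ)), P {ω | X x.toNNReal ω ∈ B} = 0) := by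
    intro p B hB
    have hm : Measurable fun t : ℝ => P {ω | X t.toNNReal ω ∈ B} :=
      (hX.measurable_measure_mem hB).comp measurable_real_toNNReal
    have hm' : Measurable fun t : ℝ => ENNReal.ofReal (Real.exp (-(p * t))) :=
      ((measurable_const_mul (p : ℝ)).neg.exp).ennreal_ofReal
    have hmul : Measurable fun t : ℝ =>
      ENNReal.ofReal (Real.exp (-(p * t))) * P {ω | X t.toNNReal ω ∈ B} := hm'.mul hm
    rw [potentialMeasure, lintegral_eq_zero_iff hmul]
    refine eventually_congr (Eventually.of_forall fun x => ?_)
    simp [Real.exp_pos]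
  constructor
  · rintro ⟨p, hp⟩ B hB hB0
    exact (key p B hB).1 (hp B hB hB0)
  · intro h
    exact ⟨0, fun B hB hB0 => (key 0 B hB).2 (h B hB hB0)⟩

end ExponentialTime

/-! ### The two implications for the canonical integral. -/

section AbsoluteContinuity

/-- The integrand sees only left limits of `f` (and `f 0`), hence is `1` on `[0, t]`, and the sums
telescope. -/
lemma IsGoodPair.expIntegral_eq_sub {f g : ℝ≥0 → ℝ} (hfg : IsGoodPair f g) {M : ℕ}
    (hf : ∀ n, ∀ k ≤ M * 2 ^ n, f (dyadic n k) = 0) {t : ℝ≥0} (ht : t ≤ M) :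
    expIntegral t (f, g) = g t - g 0 := by
  have h0 : f 0 = 0 := by simpa [dyadic] using hf 0 0 (Nat.zero_le _)
  have h1 : ∀ s : ℝ≥0, s < M → f s = 0 := fun s hs => by
    refine eq_of_forall_isDyadic (fun t => (hfg.left t).1) (a := 0) (b := M) ?_ zero_le hs
    rintro _ ⟨n, k, rfl⟩ - hk
    rw [← dyadic_mul_pow n M, dyadic_lt_dyadic] at hk
    exact hf n k hk.le
  have h2 : ∀ s ≤ t, Real.exp (-leftVal s f) = 1 := fun s hs => by
    rw [leftVal_eq_leftLim hfg.left]
    rcases eq_or_ne s 0 with rfl | hs0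
    · rw [leftLim_eq_of_isBot (a := (0 : ℝ≥0)) fun _ => zero_le, h0]
      simp
    · rw [leftLim_eq_of_forall_Ioo (pos_iff_ne_zero.2 hs0) fun u _ hu =>
        h1 u (hu.trans_le (hs.trans ht))]
      simp
  have h3 : ∀ n, pathSum (fun s => Real.exp (-leftVal s f)) g (dyadic n) t = g t - g 0 :=
    fun n => by
      rw [pathSum_congr (isPartitionSeq_dyadic.isPartition n) h2,
        pathSum_one g (isPartitionSeq_dyadic.isPartition n)]
  simp only [expIntegral, h3]
  exact tendsto_const_nhds.limsup_eq

variable {Ω : Type*} [MeasurableSpace Ω] {P : Measure Ω} [IsProbabilityMeasure P]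
  {ξ η : ℝ≥0 → Ω → ℝ} {τ : Ω → ℝ≥0} {q : ℝ}

lemma IsCompoundPoisson.ae_isGoodPair (hξ : IsCompoundPoisson ξ P) (hη : IsLevyProcess η P) :
    ∀ᵐ ω ∂P, IsGoodPair (fun t => ξ t ω) (fun t => η t ω) := by
  filter_upwards [hξ.isLevyProcess.cadlag, hη.cadlag, hξ.ae_isLeftStep] with ω h1 h2 h3
  exact ⟨h1, h2, h3⟩

lemma acpCondition_of_null (hq : 0 < q) (hξ : IsCompoundPoisson ξ P) (hη : IsLevyProcess η P)
    (hτm : Measurable τ) (hτ : HasLaw (fun ω => (τ ω : ℝ)) (expMeasure q) P)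
    (hξη : IndepFun (fun ω t => ξ t ω) (fun ω t => η t ω) P)
    (hξητ : IndepFun (fun ω => ((fun t => ξ t ω), (fun t => η t ω))) τ P)
    (h : ∀ B : Set ℝ, MeasurableSet B → volume B = 0 →
      P {ω | expIntegralProcess ξ η (τ ω) ω ∈ B} = 0) : ACPCondition η P := by
  have hξm : Measurable fun ω t => ξ t ω := measurable_pi_lambda _ hξ.isLevyProcess.measurable
  have hηm : Measurable fun ω t => η t ω := measurable_pi_lambda _ hη.measurable
  obtain ⟨l, hl⟩ := hξ.exists_rate
  have hind := indepFun_prodMk_of_prodMk hξm hηm hτm hξη hξητ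
  refine hη.acpCondition_iff.2 fun B hB hB0 => ?_
  let S : Set (ℝ≥0 × (ℝ≥0 → ℝ)) := {p | evalRight p.1 p.2 ∈ B}
  have hS : MeasurableSet S := measurable_evalRight hB
  have hM : ∀ M : ℕ, P {ω | τ ω ≤ M ∧ (τ ω, fun t => η t ω) ∈ S} = 0 := by
    intro M
    let S1 : Set (ℝ≥0 → ℝ) := {f | ∀ n, ∀ k ≤ M * 2 ^ n, f (dyadic n k) = 0}
    have hS1 : MeasurableSet S1 := by
      simp only [S1, Set.ofPred_forall]
      exact MeasurableSet.iInter fun n => MeasurableSet.iInter fun k =>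
        MeasurableSet.iInter fun _ => measurable_pi_apply _ (measurableSet_singleton 0)
    let S2 : Set ((ℝ≥0 → ℝ) × ℝ≥0) := {p | p.2 ≤ M} ∩ Prod.swap ⁻¹' S
    have hS2 : MeasurableSet S2 :=
      (measurableSet_le measurable_snd measurable_const).inter (measurable_swap hS)
    -- The event that `ξ` stays at `0` is independent of `(η, τ)`. On the intersection the integral
    -- is `η_τ`, so the product is zero; its first factor is positive.
    have h1 := hind.measure_inter_preimage_eq_mul S1 S2 hS1 hS2
    have h2 : P ((fun ω t => ξ t ω) ⁻¹' S1 ∩ (fun ω => ((fun t => η t ω), τ ω)) ⁻¹' S2) = 0 := by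
      refine measure_mono_null_ae ?_ (h B hB hB0)
      filter_upwards [hξ.ae_isGoodPair hη, hη.start_zero, hη.ae_evalRight_eq]
        with ω hgood h0 hev hω
      obtain ⟨hω1, hω2, hω3⟩ := hω
      change expIntegral (τ ω) _ ∈ B
      rw [hgood.expIntegral_eq_sub hω1 hω2, h0, sub_zero, ← hev]
      exact hω3
    rw [h2] at h1
    exact (mul_eq_zero.1 h1.symm).resolve_left
      (measure_forall_isDyadic_eq_zero_pos hξ.isLevyProcess hl M).ne'
  have h1 : P ((fun ω => (τ ω, fun t => η t ω)) ⁻¹' S) = 0 := by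
    refine measure_mono_null (fun ω hω => ?_) (measure_iUnion_null hM)
    obtain ⟨M, hM⟩ := exists_nat_ge (τ ω)
    exact Set.mem_iUnion.2 ⟨M, hM, hω⟩
  have hτη : IndepFun τ (fun ω t => η t ω) P :=
    (hξητ.comp measurable_snd measurable_id).symm
  have := Measure.isProbabilityMeasure_map (μ := P) hηm.aemeasurable
  rw [← Measure.map_apply (hτm.prodMk hηm) hS,
    hτη.map_prod_eq_prod_map_map hτm.aemeasurable hηm.aemeasurable,
    Measure.measure_prod_null hS] at h1
  have h2 : ∀ᵐ t ∂P.map τ, P {ω | η t ω ∈ B} = 0 := by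
    filter_upwards [h1] with t ht
    rw [Pi.zero_apply, Measure.map_apply hηm (measurable_prodMk_left hS)] at ht
    refine measure_mono_null_ae ?_ ht
    filter_upwards [hη.ae_evalRight_eq] with ω hω hωB
    change evalRight t (fun s => η s ω) ∈ B
    rwa [hω t]
  exact (ae_map_exponential_iff hq hτm hτ
    (hη.measurable_measure_mem hB (measurableSet_singleton 0))).1 h2

/-- Under the ACP condition the law of `a + b η_{t - r}` does not charge a given null set, for
almost every `t > r`. -/
lemma IsLevyProcess.ae_measure_affine_eq_zero (hη : IsLevyProcess η P) (hacp : ACPCondition η P)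
    (hq : 0 < q) (hτm : Measurable τ) (hτ : HasLaw (fun ω => (τ ω : ℝ)) (expMeasure q) P)
    {B : Set ℝ} (hB : MeasurableSet B) (hB0 : volume B = 0) (r : ℝ≥0) (a : ℝ) {b : ℝ}
    (hb : b ≠ 0) : ∀ᵐ t ∂P.map τ, r < t → P {ω | a + b * η (t - r) ω ∈ B} = 0 := by
  have hm : Measurable fun x : ℝ => a + b * x := by fun_prop
  have hnull : volume ((fun x => a + b * x) ⁻¹' B) = 0 := by
    have h1 : (fun x => a + b * x) ⁻¹' B = (b * ·) ⁻¹' ((a + ·) ⁻¹' B) := rfl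
    rw [h1, Real.volume_preimage_mul_left hb, measure_preimage_add, hB0, mul_zero]
  have h2 := hη.acpCondition_iff.1 hacp _ (hm hB) hnull
  rw [ae_restrict_iff' measurableSet_Ioi] at h2
  -- Lebesgue measure is translation invariant, so exceptional times stay null after a shift by `r`.
  have h3 : ∀ᵐ x : ℝ, x - r ∈ Set.Ioi (0 : ℝ) →
      P {ω | η (x - r).toNNReal ω ∈ (fun x => a + b * x) ⁻¹' B} = 0 :=
    (measurePreserving_sub_right volume (r : ℝ)).quasiMeasurePreserving.ae h2
  have hmeas : MeasurableSet {t : ℝ≥0 | r < t → P {ω | a + b * η (t - r) ω ∈ B} = 0} := by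
    have h4 : Measurable fun t : ℝ≥0 => P {ω | η (t - r) ω ∈ (fun x => a + b * x) ⁻¹' B} :=
      (hη.measurable_measure_mem (hm hB)).comp (measurable_id.sub_const r)
    have h5 : {t : ℝ≥0 | r < t → P {ω | a + b * η (t - r) ω ∈ B} = 0} = (Set.Ioi r)ᶜ ∪
        {t | P {ω | η (t - r) ω ∈ (fun x => a + b * x) ⁻¹' B} = 0} := by
      ext t
      exact imp_iff_not_or
    rw [h5]
    exact measurableSet_Ioi.compl.union (h4 (measurableSet_singleton 0))
  rw [ae_map_exponential_iff hq hτm hτ hmeas]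
  refine ae_restrict_of_ae ?_
  filter_upwards [h3] with x hx hrx
  have h6 : (r : ℝ) < x := by
    rw [Real.lt_toNNReal_iff_coe_lt] at hrx
    exact hrx
  have h7 : (x - r).toNNReal = x.toNNReal - r := by
    rw [NNReal.sub_def, Real.coe_toNNReal x (r.coe_nonneg.trans h6.le)]
  have h8 := hx (sub_pos.2 h6)
  rwa [h7] at h8

/-- Integrand and integral at time `r` are independent of later increments of the integrator. -/
lemma indepFun_expIntegral_sub (hξ : ∀ t, Measurable (ξ t)) (hη : IsLevyProcess η P)
    (hξη : IndepFun (fun ω t => ξ t ω) (fun ω t => η t ω) P) {r t : ℝ≥0} (hrt : r ≤ t) :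
    IndepFun (fun ω => (expIntegralProcess ξ η r ω, Real.exp (-leftVal r fun s => ξ s ω)))
      (fun ω => η t ω - η r ω) P := by
  have hξm : Measurable fun ω t => ξ t ω := measurable_pi_lambda _ hξ
  have hsm : Measurable fun ω u => η (min u r) ω :=
    measurable_pi_lambda _ fun _ => hη.measurable _
  have hDm : Measurable fun ω => η t ω - η r ω := (hη.measurable t).sub (hη.measurable r)
  -- The integral up to `r` depends on `η` only through its path stopped at `r`, which the later
  -- increment does not see.
  have h1 := (hη.indepFun_stopped_sub hrt).symm
  have h2 : IndepFun (fun ω => (η t ω - η r ω, fun u => η (min u r) ω)) (fun ω t => ξ t ω) P := by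
    refine (hξη.comp (φ := id) (ψ := fun g : ℝ≥0 → ℝ => (g t - g r, fun u => g (min u r)))
      measurable_id ?_).symm
    exact ((measurable_pi_apply t).sub (measurable_pi_apply r)).prodMk
      (measurable_pi_lambda _ fun u => measurable_pi_apply _)
  have h3 := (indepFun_prodMk_of_prodMk hDm hsm hξm h1 h2).symm
  have hF : Measurable fun p : (ℝ≥0 → ℝ) × (ℝ≥0 → ℝ) =>
      (expIntegral r p.swap, Real.exp (-leftVal r p.2)) :=
    ((measurable_expIntegral r).comp measurable_swap).prodMk
      ((measurable_leftVal r).comp measurable_snd).neg.exp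
  have h4 := h3.comp hF measurable_id
  convert h4 using 1
  · ext ω
    · exact (expIntegral_stopped r (fun s => ξ s ω) fun s => η s ω).symm
    · rfl
  · rfl

/-- After a fixed time `r`, an increment of the integrator scaled and shifted by the past does not
charge a null set at an independent exponential time. -/
lemma measure_expIntegral_add_mem_eq_zero (hq : 0 < q) (hξ : ∀ t, Measurable (ξ t))
    (hη : IsLevyProcess η P) (hτm : Measurable τ)
    (hτ : HasLaw (fun ω => (τ ω : ℝ)) (expMeasure q) P)
    (hξη : IndepFun (fun ω t => ξ t ω) (fun ω t => η t ω) P)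
    (hξητ : IndepFun (fun ω => ((fun t => ξ t ω), (fun t => η t ω))) τ P)
    (hacp : ACPCondition η P) {B : Set ℝ} (hB : MeasurableSet B) (hB0 : volume B = 0) (r : ℝ≥0) :
    P {ω | r < τ ω ∧ expIntegralProcess ξ η r ω +
      Real.exp (-leftVal r fun s => ξ s ω) * (η (τ ω) ω - η r ω) ∈ B} = 0 := by
  have hξm : Measurable fun ω t => ξ t ω := measurable_pi_lambda _ hξ
  have hηm : Measurable fun ω t => η t ω := measurable_pi_lambda _ hη.measurable
  have hpm : Measurable fun ω => ((fun t => ξ t ω), (fun t => η t ω)) := hξm.prodMk hηm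
  let Z : Ω → ℝ × ℝ := fun ω =>
    (expIntegralProcess ξ η r ω, Real.exp (-leftVal r fun s => ξ s ω))
  have hZ : Measurable Z := (measurable_expIntegralProcess hξ hη.measurable r).prodMk
    ((measurable_leftVal r).comp hξm).neg.exp
  let S : Set (ℝ≥0 × ((ℝ≥0 → ℝ) × (ℝ≥0 → ℝ))) := {p | r < p.1 ∧
    expIntegral r p.2 + Real.exp (-leftVal r p.2.1) * (evalRight p.1 p.2.2 - p.2.2 r) ∈ B}
  have hS : MeasurableSet S := by
    have hev : Measurable fun p : ℝ≥0 × ((ℝ≥0 → ℝ) × (ℝ≥0 → ℝ)) => evalRight p.1 p.2.2 := by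
      have h := measurable_evalRight.comp (measurable_fst.prodMk
        (measurable_snd.comp measurable_snd) :
          Measurable fun p : ℝ≥0 × ((ℝ≥0 → ℝ) × (ℝ≥0 → ℝ)) => (p.1, p.2.2))
      simpa only [Function.comp_def] using h
    have h1 : Measurable fun p : ℝ≥0 × ((ℝ≥0 → ℝ) × (ℝ≥0 → ℝ)) =>
        expIntegral r p.2 + Real.exp (-leftVal r p.2.1) * (evalRight p.1 p.2.2 - p.2.2 r) :=
      ((measurable_expIntegral r).comp measurable_snd).add
        ((((measurable_leftVal r).comp (measurable_fst.comp measurable_snd)).neg.exp).mul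
          (hev.sub ((measurable_pi_apply r).comp (measurable_snd.comp measurable_snd))))
    exact (measurableSet_lt measurable_const measurable_fst).inter (h1 hB)
  have hτpair := hξητ.symm.map_prod_eq_prod_map_map hτm.aemeasurable hpm.aemeasurable
  have := Measure.isProbabilityMeasure_map (μ := P) hpm.aemeasurable
  have := Measure.isProbabilityMeasure_map (μ := P) hZ.aemeasurable
  have := Measure.isProbabilityMeasure_map (μ := P) hτm.aemeasurable
  have h1 : P ((fun ω => (τ ω, ((fun t => ξ t ω), (fun t => η t ω)))) ⁻¹' S) = 0 := by
    rw [← Measure.map_apply (hτm.prodMk hpm) hS, hτpair, Measure.measure_prod_null hS]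
    -- A jointly measurable version of `a + b η_{t-r}`.
    let Y : (ℝ≥0 × (ℝ × ℝ)) → Ω → ℝ := fun p ω =>
      p.2.1 + p.2.2 * evalRight (p.1 - r) fun s => η s ω
    have hY : Measurable fun p : (ℝ≥0 × (ℝ × ℝ)) × Ω => Y p.1 p.2 := by
      have h2 := measurable_evalRight_comp (α := (ℝ≥0 × (ℝ × ℝ)) × Ω)
        (τ := fun p => p.1.1 - r) (X := fun s p => η s p.2)
        ((measurable_fst.comp measurable_fst).sub_const r)
        (fun t => (hη.measurable t).comp measurable_snd)
      exact (measurable_fst.comp (measurable_snd.comp measurable_fst)).add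
        ((measurable_snd.comp (measurable_snd.comp measurable_fst)).mul h2)
    have hYη : ∀ t a b, P {ω | Y (t, (a, b)) ω ∈ B} = P {ω | a + b * η (t - r) ω ∈ B} := by
      intro t a b
      refine measure_congr ?_
      filter_upwards [hη.ae_evalRight_eq] with ω hω
      change (a + b * evalRight (t - r) (fun s => η s ω) ∈ B) = (a + b * η (t - r) ω ∈ B)
      rw [hω]
    have hΨ := measurable_measure_mem (P := P) hY hB
    have hΨ0 : ∀ᵐ z ∂P.map Z, ∀ᵐ t ∂P.map τ, r < t → P {ω | Y (t, z) ω ∈ B} = 0 := by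
      have h2 : MeasurableSet {z : ℝ × ℝ | z.2 ≠ 0} :=
        (measurable_snd (measurableSet_singleton 0)).compl
      have h3 : ∀ᵐ z ∂P.map Z, z.2 ≠ 0 :=
        (ae_map_iff hZ.aemeasurable h2).2 (Eventually.of_forall fun ω => (Real.exp_pos _).ne')
      filter_upwards [h3] with z hz
      filter_upwards [hη.ae_measure_affine_eq_zero hacp hq hτm hτ hB hB0 r z.1 hz] with t ht hrt
      rw [hYη]
      exact ht hrt
    have hset : MeasurableSet {p : (ℝ × ℝ) × ℝ≥0 |
        r < p.2 → P {ω | Y (p.2, p.1) ω ∈ B} = 0} := by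
      have h4 : {p : (ℝ × ℝ) × ℝ≥0 | r < p.2 → P {ω | Y (p.2, p.1) ω ∈ B} = 0} =
          {p | r < p.2}ᶜ ∪ {p | P {ω | Y p.swap ω ∈ B} = 0} := by
        ext p
        exact imp_iff_not_or
      rw [h4]
      exact (measurableSet_lt measurable_const measurable_snd).compl.union
        ((hΨ.comp measurable_swap) (measurableSet_singleton 0))
    -- The exceptional times given by ACP depend on the past value `z`; Fubini exchanges the
    -- quantifiers so that `t` can be fixed before `z`.
    have hswap : ∀ᵐ t ∂P.map τ, ∀ᵐ z ∂P.map Z, r < t → P {ω | Y (t, z) ω ∈ B} = 0 :=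
      (Measure.ae_ae_comm hset).1 hΨ0
    filter_upwards [hswap] with t ht
    rw [Pi.zero_apply, Measure.map_apply hpm (measurable_prodMk_left hS)]
    rcases le_or_gt t r with htr | hrt
    · refine measure_mono_null (t := ∅) (fun ω hω => ?_) measure_empty
      exact absurd hω.1 (not_lt.2 htr)
    let D : Ω → ℝ := fun ω => η t ω - η r ω
    have hD : Measurable D := (hη.measurable t).sub (hη.measurable r)
    have hZD : IndepFun Z D P := indepFun_expIntegral_sub hξ hη hξη hrt.le
    have := Measure.isProbabilityMeasure_map (μ := P) hD.aemeasurable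
    let A : Set ((ℝ × ℝ) × ℝ) := {p | p.1.1 + p.1.2 * p.2 ∈ B}
    have hA : MeasurableSet A := by
      have h5 : Measurable fun p : (ℝ × ℝ) × ℝ => p.1.1 + p.1.2 * p.2 := by fun_prop
      exact h5 hB
    -- For fixed `t`, integrate over the independent past `Z`; `D` has the law of `η_{t-r}`.
    have h6 : P ((fun ω => (Z ω, D ω)) ⁻¹' A) = 0 := by
      rw [← Measure.map_apply (hZ.prodMk hD) hA,
        hZD.map_prod_eq_prod_map_map hZ.aemeasurable hD.aemeasurable, Measure.measure_prod_null hA]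
      filter_upwards [ht] with z hz
      have h7 := hη.stationary_increments r (t - r)
      rw [add_tsub_cancel_of_le hrt.le] at h7
      rw [Pi.zero_apply, h7.map_eq, Measure.map_apply (hη.measurable _) (measurable_prodMk_left hA)]
      have h8 := hz hrt
      rw [hYη] at h8
      exact h8
    refine measure_mono_null_ae ?_ h6
    filter_upwards [hη.ae_evalRight_eq] with ω hω hωS
    have h9 := hωS.2
    simp only [hω] at h9
    exact h9
  refine measure_mono_null_ae ?_ h1
  filter_upwards [hη.ae_evalRight_eq] with ω hω hωB
  refine ⟨hωB.1, ?_⟩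
  simp only [hω]
  exact hωB.2

lemma measure_expIntegralProcess_mem_eq_zero (hq : 0 < q) (hξ : IsCompoundPoisson ξ P)
    (hη : IsLevyProcess η P) (hτm : Measurable τ)
    (hτ : HasLaw (fun ω => (τ ω : ℝ)) (expMeasure q) P)
    (hξη : IndepFun (fun ω t => ξ t ω) (fun ω t => η t ω) P)
    (hξητ : IndepFun (fun ω => ((fun t => ξ t ω), (fun t => η t ω))) τ P)
    (hacp : ACPCondition η P) {B : Set ℝ} (hB : MeasurableSet B) (hB0 : volume B = 0) :
    P {ω | expIntegralProcess ξ η (τ ω) ω ∈ B} = 0 := by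
  have hpos : ∀ᵐ ω ∂P, 0 < τ ω := by
    refine ae_of_ae_map hτm.aemeasurable ((ae_map_exponential_iff hq hτm hτ
      (p := fun t => 0 < t) measurableSet_Ioi).2 ?_)
    filter_upwards [ae_restrict_mem measurableSet_Ioi] with x hx
    exact Real.toNNReal_pos.2 hx
  refine measure_mono_null_ae ?_ (measure_iUnion_null fun n => measure_iUnion_null fun k =>
    measure_expIntegral_add_mem_eq_zero hq hξ.isLevyProcess.measurable hη hτm hτ hξη hξητ hacp hB
      hB0 (dyadic n k))
  filter_upwards [hpos, hξ.ae_isGoodPair hη] with ω h0 hgood hωB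
  -- Just before `τ` the integral moves like a multiple of `η`, so some dyadic time places `ω` in
  -- the countable union.
  obtain ⟨a, ha, hA⟩ := (mem_nhdsLT_iff_exists_Ioo_subset' h0).1
    ((hgood.isPathIntegral (τ ω)).local_eq (τ ω) h0 le_rfl)
  obtain ⟨_, ⟨n, k, rfl⟩, h1, h2⟩ := exists_isDyadic_between (show a < τ ω from ha)
  refine Set.mem_iUnion.2 ⟨n, Set.mem_iUnion.2 ⟨k, h2, ?_⟩⟩
  have h3 : expIntegralProcess ξ η (τ ω) ω - expIntegralProcess ξ η (dyadic n k) ω =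
    Real.exp (-leftVal (dyadic n k) fun s => ξ s ω) * (η (τ ω) ω - η (dyadic n k) ω) := hA ⟨h1, h2⟩
  rw [← h3, add_sub_cancel]
  exact hωB

end AbsoluteContinuity

end KilledExpFunctional

end

theorem mainTheorem6 {Ω : Type*} [MeasurableSpace Ω] (P : Measure Ω) [IsProbabilityMeasure P]
    (ξ η : ℝ≥0 → Ω → ℝ) (τ : Ω → ℝ≥0) (q : ℝ) (hq : 0 < q)
    (hξ : KilledExpFunctional.IsCompoundPoisson ξ P)
    (hη : KilledExpFunctional.IsLevyProcess η P)
    (hτm : Measurable τ) (hτ : HasLaw (fun ω => (τ ω : ℝ)) (expMeasure q) P)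
    (hξη : IndepFun (fun ω t => ξ t ω) (fun ω t => η t ω) P)
    (hξητ : IndepFun (fun ω => ((fun t => ξ t ω), (fun t => η t ω))) τ P) :
    (∃ V : Ω → ℝ, KilledExpFunctional.IsExpFunctional ξ η τ P V) ∧
      ∀ V : Ω → ℝ, KilledExpFunctional.IsExpFunctional ξ η τ P V →
        (KilledExpFunctional.IsAbsolutelyContinuousRV V P ↔
          KilledExpFunctional.ACPCondition η P) := by
  open KilledExpFunctional in
  have hgood := hξ.ae_isGoodPair hη
  have hξm := hξ.isLevyProcess.measurable
  have hI := isStochasticIntegral_expIntegralProcess hξm hη.measurable hgood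
  refine ⟨⟨_, _, hI, EventuallyEq.rfl⟩, ?_⟩
  rintro V ⟨I, hI', hV⟩
  -- Uniqueness up to indistinguishability, rather than at fixed times, allows evaluation at the
  -- random time `τ`.
  have hVI : V =ᵐ[P] fun ω => expIntegralProcess ξ η (τ ω) ω := by
    filter_upwards [hV, hI'.ae_eq hI] with ω h1 h2
    rw [h1, h2]
  have hVm : AEMeasurable V P :=
    (aemeasurable_expIntegralProcess_comp hξm hη.measurable hgood hτm).congr hVI.symm
  have hVB : ∀ B, P {ω | expIntegralProcess ξ η (τ ω) ω ∈ B} = P (V ⁻¹' B) := fun B => by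
    refine measure_congr ?_
    filter_upwards [hVI] with ω hω
    change (expIntegralProcess ξ η (τ ω) ω ∈ B) = (V ω ∈ B)
    rw [hω]
  constructor
  · rintro ⟨-, hac⟩
    refine acpCondition_of_null hq hξ hη hτm hτ hξη hξητ fun B hB hB0 => ?_
    rw [hVB, ← Measure.map_apply_of_aemeasurable hVm hB]
    exact hac hB0
  · intro hacp
    refine ⟨hVm, Measure.AbsolutelyContinuous.mk fun B hB hB0 => ?_⟩
    rw [Measure.map_apply_of_aemeasurable hVm hB, ← hVB]
    exact measure_expIntegralProcess_mem_eq_zero hq hξ hη hτm hτ hξη hξητ hacp hB hB0
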